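/- Let $(A,B)\subset\mathbb{R}$ be a bounded interval and let $p,r:(A,B)\to\mathbb{R}$ be positive functions such that $p,p',r,r'$ are absolutely continuous on every compact subinterval of $(A,B)$, $\int_A^B (r/p)^{1/2}\,ds<\infty$, and $\rho:=(pr)^{1/4}$ extends continuously to $[A,B]$. Let $q:(A,B)\to\mathbb{C}$. Let $y_0\in(A,B)$ be such that $$\int_A^{y_0}\Big(\frac{r}{p}\Big)^{1/2}ds=\int_{y_0}^B\Big(\frac{r}{p}\Big)^{1/2}ds=:b ,\qquad l(y):=\int_{y_0}^{y}\Big(\frac{r}{p}\Big)^{1/2}ds ,$$ and let $Q:[-b,b]\to\mathbb{C}$ be a continuous function with $$Q(l(y))=\frac{q(y)}{r(y)}-\Big(\frac{p(y)}{r(y)^{3}}\Big)^{1/4}\Big[p(y)\big((p(y)r(y))^{-1/4}\big)'\Big]'\quad\text{for a.e. } y\in(A,B).$$ Let $f\in C^2[-b,b]$ satisfy $f''=Qf$, $f\neq0$ on $[-b,b]$ and $f(0)=1$, and put $h:=f'(0)\in\mathbb{C}$. Then $l$ is a bijection of $[A,B]$ onto $[-b,b]$, and the Goursat problem $$\Big(\frac{\partial^2}{\partial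 x^2}-Q(x)\Big)K(x,t)=\frac{\partial^2}{\partial t^2}K(x,t),\qquad K(x,x)=\frac12\int_0^xQ(s)\,ds,\qquad K(x,-x)=0$$ has a unique solution $K$ on $[-b,b]^2$. (A solution is a function continuous on $[-b,b]^2$ and $C^1$ in its interior; as $Q$ is only continuous, the equation is understood as $(\partial_x+\partial_t)\big((\partial_x-\partial_t)K\big)=Q(x)K$, the outer derivative being a directional derivative.) Put $$\mathbf{K}(x,t;h)=\frac h2+K(x,t)+\frac h2\int_t^x\big(K(x,s)-K(x,-s)\big)ds .$$ The formulas $$L[v](x)=\rho(l^{-1}(x))\,v(l^{-1}(x)),\qquad \mathbf{T}u(x)=u(x)+\int_{-x}^{x}\mathbf{K}(x,t;h)u(t)\,dt$$ define a bounded linear operator $L:C[A,B]\to C[-b,b]$ and a bounded, boundedly invertible linear operator $\mathbf{T}$ on $C[-b,b]$ (spaces of complex-valued functions). With $$A=-\frac{d^2}{dx^2},\qquad C=-\frac1r\Big(\frac{d}{dy}\,p\,\frac{d}{dy}-q\Big),$$ the operator $\mathbf{T}^{-1}L$ is a transmutation operator for the pair $A$ and $C$ on $C^2[A,B]$: for every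 $v\in C^2[A,B]$ with $Cv\in C[A,B]$ (that is, $Cv$ agrees a.e. on $(A,B)$ with a function continuous on $[A,B]$; this holds for every $v\in C^2[A,B]$ when $p/r$, $p'/r$, $q/r$ extend continuously to $[A,B]$), one has $\mathbf{T}^{-1}Lv\in C^2[-b,b]$ and $$A\,\mathbf{T}^{-1}L\,v=\mathbf{T}^{-1}L\,C\,v\quad\text{on }[-b,b].$$ -/

import Mathlib

open MeasureTheory Set

noncomputable section

namespace LiouvilleTransmutation

/-- `f` is absolutely continuous on every compact subinterval of `(A, B)`. -/
def ACLoc (f : ℝ → ℝ) (A B : ℝ) : Prop :=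
  ∀ c d : ℝ, A < c → c ≤ d → d < B → AbsolutelyContinuousOnInterval f c d

/-- Hypotheses on a leading coefficient or a weight `p` on `(A, B)`: `p` is positive and
`p`, `p'` are locally absolutely continuous. -/
structure IsCoefficient (p : ℝ → ℝ) (A B : ℝ) : Prop where
  pos : ∀ y ∈ Ioo A B, 0 < p y
  differentiable : ∀ y ∈ Ioo A B, DifferentiableAt ℝ p y
  acLoc : ACLoc p A B
  acLoc_deriv : ACLoc (deriv p) A B

/-- The change of variable `l(y) = ∫_{y₀}^y (r/p)^{1/2} ds` (base point `x₀ = 0`). -/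
def liouvilleMap (p r : ℝ → ℝ) (y₀ y : ℝ) : ℝ :=
  ∫ s in y₀..y, (r s / p s) ^ (1 / 2 : ℝ)

/-- The inverse of `l` on `[A, B]`. -/
def liouvilleInv (p r : ℝ → ℝ) (A B y₀ x : ℝ) : ℝ :=
  Function.invFunOn (liouvilleMap p r y₀) (Icc A B) x

/-- `ρ(y) = (p(y) r(y))^{1/4}`. -/
def rho (p r : ℝ → ℝ) (y : ℝ) : ℝ :=
  (p y * r y) ^ (1 / 4 : ℝ)

/-- The potential of the transformed equation, as a function of `y`:
`q/r - (r^{-3} p)^{1/4} [p ((p r)^{-1/4})']'`. -/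
def potential (p r : ℝ → ℝ) (q : ℝ → ℂ) (y : ℝ) : ℂ :=
  q y / (r y : ℂ) -
    ((((r y) ^ (-3 : ℝ) * p y) ^ (1 / 4 : ℝ) *
      deriv (fun s => p s * deriv (fun τ => (p τ * r τ) ^ (-(1 / 4) : ℝ)) s) y : ℝ) : ℂ)

/-- A continuous function on `[a, b]` seen as a function on `ℝ` (only its values on `[a, b]`
are ever used). -/
def toFun {a b : ℝ} (v : C(Icc a b, ℂ)) : ℝ → ℂ :=
  Function.extend Subtype.val v 0

/-- `v ∈ C²[a, b]` (one-sided derivatives at the endpoints). -/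
def IsC2 {a b : ℝ} (v : C(Icc a b, ℂ)) : Prop :=
  ContDiffOn ℝ 2 (toFun v) (Icc a b)

/-- `A w = -w''` on `[a, b]` (one-sided derivatives at the endpoints). -/
def opA {a b : ℝ} (w : C(Icc a b, ℂ)) (x : ℝ) : ℂ :=
  -iteratedDerivWithin 2 (toFun w) (Icc a b) x

/-- `C v = -(1/r) ((p v')' - q v)`, at interior points of `[A, B]`. -/
def opC (p r : ℝ → ℝ) (q : ℝ → ℂ) {A B : ℝ} (v : C(Icc A B, ℂ)) (y : ℝ) : ℂ :=
  -(1 / (r y : ℂ)) *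
    (deriv (fun s => (p s : ℂ) * deriv (toFun v) s) y - q y * toFun v y)

/-- `K` solves, on the square `[-b, b]²`, the Goursat problem
`K_xx - Q(x) K = K_tt`, `K(x, x) = (1/2) ∫_0^x Q`, `K(x, -x) = 0`.

Since `Q` is only continuous, `K` need not be twice differentiable, so the equation is read as
`(∂_x + ∂_t) (∂_x - ∂_t) K = Q(x) K` for a `C¹` function `K`; for `K` of class `C²` this is the
equation as displayed. -/
structure IsGoursatSolution (Q : ℝ → ℂ) (b : ℝ) (K : ℝ × ℝ → ℂ) : Prop where
  continuousOn : ContinuousOn K (Icc (-b) b ×ˢ Icc (-b) b)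
  contDiffOn : ContDiffOn ℝ 1 K (Ioo (-b) b ×ˢ Ioo (-b) b)
  equation : ∀ x ∈ Ioo (-b) b, ∀ t ∈ Ioo (-b) b,
    HasLineDerivAt ℝ (fun z : ℝ × ℝ => fderiv ℝ K z (1, -1)) (Q x * K (x, t)) (x, t) (1, 1)
  diagonal : ∀ x ∈ Icc (-b) b, K (x, x) = 1 / 2 * ∫ s in (0 : ℝ)..x, Q s
  antidiagonal : ∀ x ∈ Icc (-b) b, K (x, -x) = 0

/-- `𝐊(x, t; h) = h/2 + K(x, t) + (h/2) ∫_t^x (K(x, s) - K(x, -s)) ds`. -/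
def kernelH (K : ℝ × ℝ → ℂ) (h : ℂ) (x t : ℝ) : ℂ :=
  h / 2 + K (x, t) + h / 2 * ∫ s in t..x, (K (x, s) - K (x, -s))

end LiouvilleTransmutation

end

noncomputable section

namespace LiouvilleTransmutation

open Filter Topology

/-! Write `S u = u + (h/2) ∫_{-x}^x u` and `N u = u + ∫_{-x}^x K(x, t) u(t) dt`. Integration by
parts gives `T = N S` (`integral_kernelH_mul`). The factor `S` commutes with `d²/dx²`
(`hasDerivAt_symmIntegral`), and the Goursat problem is what makes `(N u)'' = Q N u + N u''`
(`hasDerivAt_transmutation`). Hence `(T u)'' = Q T u + T u''` for `u` of class `C²`. Both factors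
are `1 +` a Volterra operator, so they are invertible: an exponential weight turns the integral part
into a contraction.

On the other side, `g = L v` satisfies `g'' = Q g - L C v` in the open interval
(`exists_hasDerivAt_liouville`). Put `φ = T⁻¹ L C v`, and let `u` solve `u'' = -φ` with `u(0) =
g(0)`, `u'(0) = g'(0) - h g(0)`. Then `T u` and `g` solve the same second-order equation with the
same data at `0`, so `T u = g` (`IsCharacteristicSolution.exists_preimage`). Thus `T⁻¹ L v = u` is
`C²` with `-u'' = φ`; `T⁻¹` is never differentiated, and the endpoints follow by continuity.

In the coordinates `x = ξ + η`, `t = ξ - η` the Goursat problem becomes `H_ξη = Q(ξ + η) H` with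
data on the axes, an integral equation. Since `Q` is merely continuous, `∫ K u` is differentiated
twice using only `∂H/∂η` and its `ξ`-derivative. -/

/-! ### Exponentially weighted estimates and a Leibniz rule -/

/-- Integration from `0` gains a factor `1 / c` in the norm weighted by `exp (c |s|)`. With `c`
large, this is the source of every contraction below; the even weight treats both signs of `x`
alike. -/
theorem norm_integral_le_exp_mul_abs {g : ℝ → ℂ} {c C x : ℝ} (hc : 0 < c) (hC : 0 ≤ C)
    (hg : ∀ s ∈ uIcc 0 x, ‖g s‖ ≤ C * Real.exp (c * |s|)) :
    ‖∫ s in (0 : ℝ)..x, g s‖ ≤ C / c * Real.exp (c * |x|) := by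
  have key : ∀ (g : ℝ → ℂ) (x : ℝ), 0 ≤ x → (∀ s ∈ Icc 0 x, ‖g s‖ ≤ C * Real.exp (c * |s|)) →
      ‖∫ s in (0 : ℝ)..x, g s‖ ≤ C / c * Real.exp (c * |x|) := by
    intro g x hx hg
    have h1 : ‖∫ s in (0 : ℝ)..x, g s‖ ≤ ∫ s in (0 : ℝ)..x, C * Real.exp (c * s) := by
      refine intervalIntegral.norm_integral_le_of_norm_le hx ?_ ?_
      · refine Eventually.of_forall fun s hs => ?_
        have := hg s ⟨hs.1.le, hs.2⟩
        rwa [abs_of_nonneg hs.1.le] at this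
      · exact (by fun_prop : Continuous fun s => C * Real.exp (c * s)).intervalIntegrable _ _
    refine h1.trans ?_
    rw [intervalIntegral.integral_const_mul, intervalIntegral.integral_comp_mul_left _ hc.ne',
      integral_exp, abs_of_nonneg hx, smul_eq_mul, mul_zero, Real.exp_zero]
    rw [div_eq_mul_inv, mul_assoc]
    gcongr
    linarith
  rcases le_total 0 x with hx | hx
  · exact key g x hx (by rwa [uIcc_of_le hx] at hg)
  · have h2 := key (fun s => g (-s)) (-x) (by linarith) (fun s hs => by
      have := hg (-s) (by rw [uIcc_of_ge hx]; constructor <;> linarith [hs.1, hs.2])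
      rwa [abs_neg] at this)
    rw [intervalIntegral.integral_comp_neg, neg_neg, neg_zero, abs_neg,
      intervalIntegral.integral_symm, norm_neg] at h2
    exact h2

/-- Split the integral at the fixed point `x`: on `[0, x]` one differentiates under the integral
sign, and the short piece from `x` to `y` contributes the boundary value by continuity of `F` at
`(x, x)`. -/
theorem hasDerivAt_integral_diagonal {F F' : ℝ → ℝ → ℂ} (hF : Continuous (Function.uncurry F))
    (hF' : Continuous (Function.uncurry F'))
    (hd : ∀ x s, HasDerivAt (fun y => F y s) (F' x s) x) (x : ℝ) :
    HasDerivAt (fun y => ∫ s in (0 : ℝ)..y, F y s)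
      (F x x + ∫ s in (0 : ℝ)..x, F' x s) x := by
  have hc : ∀ y, Continuous (F y) := fun y => hF.comp (by fun_prop : Continuous fun s => (y, s))
  have hc' : ∀ y, Continuous (F' y) := fun y => hF'.comp (by fun_prop : Continuous fun s => (y, s))
  have h1 : HasDerivAt (fun y => ∫ s in (0 : ℝ)..x, F y s) (∫ s in (0 : ℝ)..x, F' x s) x := by
    obtain ⟨M, hM⟩ := ((isCompact_Icc (a := x - 1) (b := x + 1)).prod
      (isCompact_uIcc (a := (0 : ℝ)) (b := x))).exists_bound_of_continuousOn hF'.continuousOn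
    refine (intervalIntegral.hasDerivAt_integral_of_dominated_loc_of_deriv_le
      (s := Icc (x - 1) (x + 1)) (bound := fun _ => M)
      (Icc_mem_nhds (by linarith) (by linarith)) (Eventually.of_forall fun y =>
        (hc y).aestronglyMeasurable) ((hc x).intervalIntegrable _ _) (hc' x).aestronglyMeasurable
      ?_ intervalIntegrable_const ?_).2
    · exact Eventually.of_forall fun t ht y hy => hM (y, t) ⟨hy, uIoc_subset_uIcc ht⟩
    · exact Eventually.of_forall fun t _ y _ => hd y t
  have h2 : HasDerivAt (fun y => ∫ s in x..y, F y s) (F x x) x := by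
    rw [hasDerivAt_iff_isLittleO, Asymptotics.isLittleO_iff]
    intro ε hε
    obtain ⟨δ, hδ, hb⟩ := Metric.continuousAt_iff.1 (hF.continuousAt (x := (x, x))) ε hε
    filter_upwards [Metric.ball_mem_nhds x hδ] with y hy
    have e : (∫ s in x..y, F y s) - (∫ s in x..x, F x s) - (y - x) • F x x
        = ∫ s in x..y, (F y s - F x x) := by
      rw [intervalIntegral.integral_sub ((hc y).intervalIntegrable _ _) intervalIntegrable_const,
        intervalIntegral.integral_same, intervalIntegral.integral_const, sub_zero]
    rw [e, Real.norm_eq_abs]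
    refine intervalIntegral.norm_integral_le_of_norm_le_const fun s hs => ?_
    have hs' : |s - x| ≤ |y - x| := abs_sub_left_of_mem_uIcc (uIoc_subset_uIcc hs)
    have := hb (x := (y, s)) (by
      rw [Prod.dist_eq]
      exact max_lt hy (lt_of_le_of_lt hs' hy))
    exact (dist_eq_norm (F y s) (F x x) ▸ this).le
  have h3 := h2.add h1
  refine h3.congr_of_eventuallyEq (Eventually.of_forall fun y => ?_)
  simp only [Pi.add_apply]
  rw [add_comm, intervalIntegral.integral_add_adjacent_intervals ((hc y).intervalIntegrable _ _)
    ((hc y).intervalIntegrable _ _)]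

/-- A bounded operator on `C(X)` contracting a weighted supremum norm has invertible `1 + V`. -/
theorem isUnit_one_add_of_exp_weight {X : Type*} [TopologicalSpace X] [CompactSpace X]
    (V : C(X, ℂ) →L[ℂ] C(X, ℂ)) (w : C(X, ℝ)) {c : ℝ} (hc0 : 0 ≤ c) (hc : c < 1)
    (hV : ∀ (u : C(X, ℂ)) (C : ℝ), 0 ≤ C → (∀ x, ‖u x‖ ≤ C * Real.exp (w x)) →
      ∀ x, ‖V u x‖ ≤ C * c * Real.exp (w x)) : IsUnit (1 + V) := by
  -- Conjugating by multiplication with `exp w` replaces the weighted norm by the sup norm: `W' V W`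
  -- has norm at most `c < 1`, and `1 + V = W (1 + W' V W) W'`.
  let e : ℝ → C(X, ℂ) := fun s => ⟨fun x => (Real.exp (s * w x) : ℂ), by fun_prop⟩
  have he : ∀ s, e s * e (-s) = 1 := fun s => by
    ext x
    simp [e, ← Complex.exp_add]
  let W : C(X, ℂ) →L[ℂ] C(X, ℂ) := ContinuousLinearMap.mul ℂ C(X, ℂ) (e 1)
  let W' : C(X, ℂ) →L[ℂ] C(X, ℂ) := ContinuousLinearMap.mul ℂ C(X, ℂ) (e (-1))
  have hW : W * W' = 1 := by
    ext1 u
    simp [W, W', ← mul_assoc, he 1]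
  have hW' : W' * W = 1 := by
    ext1 u
    have := he (-1)
    rw [neg_neg] at this
    simp [W, W', ← mul_assoc, this]
  have hn : ‖W' * V * W‖ ≤ c := by
    refine ContinuousLinearMap.opNorm_le_bound _ hc0 fun u => ?_
    rw [ContinuousMap.norm_le _ (by positivity)]
    intro x
    have := hV (W u) ‖u‖ (norm_nonneg _) (fun y => by
      have h1 : W u y = (Real.exp (w y) : ℂ) * u y := by simp [W, e]
      rw [h1, norm_mul, Complex.norm_real, Real.norm_eq_abs, Real.abs_exp, mul_comm]
      gcongr
      exact u.norm_coe_le_norm y) x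
    have h2 : (W' * V * W) u x = (Real.exp (-w x) : ℂ) * V (W u) x := by simp [W', e]
    rw [h2, norm_mul, Complex.norm_real, Real.norm_eq_abs, Real.abs_exp]
    calc Real.exp (-w x) * ‖V (W u) x‖ ≤ Real.exp (-w x) * (‖u‖ * c * Real.exp (w x)) := by gcongr
      _ = c * ‖u‖ * (Real.exp (-w x) * Real.exp (w x)) := by ring
      _ = c * ‖u‖ := by rw [← Real.exp_add]; simp
  have hu : IsUnit (1 + W' * V * W) := by
    have := isUnit_one_sub_of_norm_lt_one (x := -(W' * V * W)) (by rw [norm_neg]; linarith)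
    rwa [sub_neg_eq_add] at this
  have hWu : IsUnit W := ⟨⟨W, W', hW, hW'⟩, rfl⟩
  have hWu' : IsUnit W' := ⟨⟨W', W, hW', hW⟩, rfl⟩
  have : 1 + V = W * (1 + W' * V * W) * W' := by
    rw [mul_add, add_mul, mul_one, hW, ← mul_assoc, ← mul_assoc, hW, one_mul, mul_assoc, hW,
      mul_one]
  rw [this]
  exact (hWu.mul hu).mul hWu'

/-! ### Existence for the Goursat problem -/

theorem continuous_goursat_integral {G : ℝ × ℝ → ℂ} (hG : Continuous G) :
    Continuous fun z : ℝ × ℝ => ∫ β in (0 : ℝ)..z.2, ∫ α in (0 : ℝ)..z.1, G (α, β) := by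
  have h1 : Continuous fun z : ℝ × ℝ => ∫ α in (0 : ℝ)..z.1, G (α, z.2) :=
    intervalIntegral.continuous_parametric_intervalIntegral_of_continuous
      (f := fun (z : ℝ × ℝ) α => G (α, z.2)) (by simp only [Function.uncurry_def]; fun_prop)
      continuous_fst
  exact intervalIntegral.continuous_parametric_intervalIntegral_of_continuous
      (f := fun (z : ℝ × ℝ) β => ∫ α in (0 : ℝ)..z.1, G (α, β))
      (h1.comp (by fun_prop : Continuous fun y : (ℝ × ℝ) × ℝ => (y.1.1, y.2))) continuous_snd

theorem norm_goursat_integral_le {G : ℝ × ℝ → ℂ} {c C ξ η : ℝ} (hc : 0 < c) (hC : 0 ≤ C)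
    (hG : ∀ α ∈ uIcc 0 ξ, ∀ β ∈ uIcc 0 η, ‖G (α, β)‖ ≤ C * Real.exp (c * |α| + c * |β|)) :
    ‖∫ β in (0 : ℝ)..η, ∫ α in (0 : ℝ)..ξ, G (α, β)‖
      ≤ C / c ^ 2 * Real.exp (c * |ξ| + c * |η|) := by
  have h1 : ∀ β ∈ uIcc 0 η, ‖∫ α in (0 : ℝ)..ξ, G (α, β)‖
      ≤ C / c * Real.exp (c * |ξ|) * Real.exp (c * |β|) := by
    intro β hβ
    refine (norm_integral_le_exp_mul_abs (C := C * Real.exp (c * |β|)) hc (by positivity)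
      fun α hα => (hG α hα β hβ).trans_eq ?_).trans_eq ?_
    · rw [Real.exp_add]; ring
    · ring
  refine (norm_integral_le_exp_mul_abs hc (by positivity) h1).trans_eq ?_
  rw [Real.exp_add]
  field_simp

/-- Solvability of the integral equation of the Goursat problem in characteristic coordinates. -/
theorem exists_goursat_integral_equation {Q : ℝ → ℂ} (hQ : Continuous Q) {M : ℝ}
    (hM : ∀ x, ‖Q x‖ ≤ M) :
    ∃ H : ℝ × ℝ → ℂ, Continuous H ∧ ∀ ξ η, H (ξ, η) =
      1 / 2 * (∫ s in (0 : ℝ)..ξ, Q s) +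
        ∫ β in (0 : ℝ)..η, ∫ α in (0 : ℝ)..ξ, Q (α + β) * H (α, β) := by
  have hM0 : 0 ≤ M := (norm_nonneg _).trans (hM 0)
  -- The double integral gains `1 / c ^ 2`, and `M < (M + 1) ^ 2`.
  set c : ℝ := M + 1 with hcdef
  have hc : 0 < c := by positivity
  let w : ℝ × ℝ → ℝ := fun z => c * |z.1| + c * |z.2|
  have hw : Continuous w := by fun_prop
  have hq : Continuous fun z : ℝ × ℝ => ∫ s in (0 : ℝ)..z.1, Q s :=
    intervalIntegral.continuous_parametric_intervalIntegral_of_continuous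
      (f := fun (_ : ℝ × ℝ) s => Q s) (by simp only [Function.uncurry_def]; fun_prop) continuous_fst
  let D : (ℝ × ℝ → ℂ) → ℝ × ℝ → ℂ := fun G z =>
    ∫ β in (0 : ℝ)..z.2, ∫ α in (0 : ℝ)..z.1, Q (α + β) * (Real.exp (w (α, β)) * G (α, β))
  have hDc : ∀ G, Continuous G → Continuous (D G) := fun G hG =>
    continuous_goursat_integral (G := fun z => Q (z.1 + z.2) * (Real.exp (w z) * G z))
      (by fun_prop)
  have hDn : ∀ G, Continuous G → ∀ N, 0 ≤ N → (∀ z, ‖G z‖ ≤ N) → ∀ z,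
      ‖D G z‖ ≤ M * N / c ^ 2 * Real.exp (w z) := by
    intro G hG N hN hGN z
    refine norm_goursat_integral_le (G := fun z => Q (z.1 + z.2) * (Real.exp (w z) * G z)) hc
      (by positivity) fun α _ β _ => ?_
    rw [norm_mul, norm_mul, Complex.norm_real, Real.norm_eq_abs, Real.abs_exp]
    calc ‖Q (α + β)‖ * (Real.exp (w (α, β)) * ‖G (α, β)‖)
        ≤ M * (Real.exp (w (α, β)) * N) := by gcongr; exacts [hM _, hGN _]
      _ = _ := by ring
  have hDs : ∀ G G', Continuous G → Continuous G' → ∀ z, D G z - D G' z = D (G - G') z := by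
    intro G G' hG hG' z
    have hi : ∀ G, Continuous G → ∀ β, Continuous
        fun α => Q (α + β) * (Real.exp (w (α, β)) * G (α, β)) := fun G hG β => by fun_prop
    have ho : ∀ G, Continuous G → Continuous
        fun β => ∫ α in (0 : ℝ)..z.1, Q (α + β) * (Real.exp (w (α, β)) * G (α, β)) := fun G hG =>
      intervalIntegral.continuous_parametric_intervalIntegral_of_continuous'
        (by simp only [Function.uncurry_def]; fun_prop) _ _
    simp only [D]
    rw [← intervalIntegral.integral_sub ((ho G hG).intervalIntegrable _ _)
      ((ho G' hG').intervalIntegrable _ _)]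
    refine intervalIntegral.integral_congr fun β _ => ?_
    rw [← intervalIntegral.integral_sub ((hi G hG β).intervalIntegrable _ _)
      ((hi G' hG' β).intervalIntegrable _ _)]
    refine intervalIntegral.integral_congr fun α _ => ?_
    simp only [Pi.sub_apply]
    ring
  -- The unknown is `G = exp (-w) H`, which is bounded on the whole plane even though `H` may grow
  -- exponentially; Banach's fixed point theorem then applies in a complete space.
  let Φ : BoundedContinuousFunction (ℝ × ℝ) ℂ → BoundedContinuousFunction (ℝ × ℝ) ℂ := fun G =>
    BoundedContinuousFunction.ofNormedAddCommGroup
      (fun z => (Real.exp (-w z) : ℂ) * (1 / 2 * (∫ s in (0 : ℝ)..z.1, Q s) + D G z))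
      (by have := hDc G G.continuous; fun_prop) (1 / 2 * (M / c) + M * ‖G‖ / c ^ 2) (by
        intro z
        have h1 : ‖∫ s in (0 : ℝ)..z.1, Q s‖ ≤ M / c * Real.exp (w z) := by
          refine (norm_integral_le_exp_mul_abs hc hM0 fun s _ => (hM s).trans ?_).trans ?_
          · exact le_mul_of_one_le_right hM0 (Real.one_le_exp (mul_nonneg hc.le (abs_nonneg _)))
          · gcongr
            simp only [w]
            linarith [mul_nonneg hc.le (abs_nonneg z.2)]
        have h2 := hDn G G.continuous ‖G‖ (norm_nonneg _) G.norm_coe_le_norm z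
        rw [norm_mul, Complex.norm_real, Real.norm_eq_abs, Real.abs_exp]
        calc Real.exp (-w z) * ‖1 / 2 * (∫ s in (0 : ℝ)..z.1, Q s) + D G z‖
            ≤ Real.exp (-w z) * (1 / 2 * (M / c * Real.exp (w z)) +
                M * ‖G‖ / c ^ 2 * Real.exp (w z)) := by
              gcongr
              refine (norm_add_le _ _).trans (add_le_add ?_ h2)
              rw [norm_mul]
              norm_num
              linarith
          _ = (1 / 2 * (M / c) + M * ‖G‖ / c ^ 2) * (Real.exp (-w z) * Real.exp (w z)) := by ring
          _ = _ := by rw [← Real.exp_add]; simp)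
  have hK : M / c ^ 2 < 1 := by
    rw [div_lt_one (by positivity)]
    nlinarith
  have hΦ : ContractingWith (M / c ^ 2).toNNReal Φ := by
    refine ⟨Real.toNNReal_lt_one.2 hK, LipschitzWith.of_dist_le_mul fun G G' => ?_⟩
    rw [Real.coe_toNNReal _ (by positivity), BoundedContinuousFunction.dist_le (by positivity)]
    intro z
    rw [dist_eq_norm]
    have e : Φ G z - Φ G' z = (Real.exp (-w z) : ℂ) * D (G - G' : ℝ × ℝ → ℂ) z := by
      rw [← hDs G G' G.continuous G'.continuous z]
      simp only [Φ, BoundedContinuousFunction.coe_ofNormedAddCommGroup]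
      ring
    have h2 := hDn (G - G' : ℝ × ℝ → ℂ) (G.continuous.sub G'.continuous) (dist G G') dist_nonneg
      (fun y => by
        rw [Pi.sub_apply, ← dist_eq_norm]; exact BoundedContinuousFunction.dist_coe_le_dist y) z
    rw [e, norm_mul, Complex.norm_real, Real.norm_eq_abs, Real.abs_exp]
    calc Real.exp (-w z) * ‖D (G - G' : ℝ × ℝ → ℂ) z‖
        ≤ Real.exp (-w z) * (M * dist G G' / c ^ 2 * Real.exp (w z)) := by gcongr
      _ = M / c ^ 2 * dist G G' * (Real.exp (-w z) * Real.exp (w z)) := by ring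
      _ = M / c ^ 2 * dist G G' := by rw [← Real.exp_add]; simp
  obtain ⟨G, hG⟩ : ∃ G, Φ G = G := ⟨_, hΦ.fixedPoint_isFixedPt⟩
  refine ⟨fun z => Real.exp (w z) * G z, by have := G.continuous; fun_prop, fun ξ η => ?_⟩
  have := DFunLike.congr_fun hG (ξ, η)
  simp only [Φ, BoundedContinuousFunction.coe_ofNormedAddCommGroup] at this
  change (Real.exp (w (ξ, η)) : ℂ) * G (ξ, η) = _
  rw [← this, ← mul_assoc, ← Complex.ofReal_mul, ← Real.exp_add]
  simp [D]

/-- `H` is the solution of the Goursat problem with potential `Q` in characteristic coordinates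
`x = ξ + η`, `t = ξ - η`, and `P = ∂H/∂η`. -/
structure IsCharacteristicSolution (Q : ℝ → ℂ) (H P : ℝ × ℝ → ℂ) : Prop where
  contDiff : ContDiff ℝ 1 H
  continuous_deriv : Continuous P
  hasDerivAt_snd : ∀ ξ η, HasDerivAt (fun s => H (ξ, s)) (P (ξ, η)) η
  hasDerivAt_fst : ∀ ξ η, HasDerivAt (fun s => P (s, η)) (Q (ξ + η) * H (ξ, η)) ξ
  fst_axis : ∀ ξ, H (ξ, 0) = 1 / 2 * ∫ s in (0 : ℝ)..ξ, Q s
  snd_axis : ∀ η, H (0, η) = 0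
  deriv_snd_axis : ∀ η, P (0, η) = 0

theorem contDiff_one_of_partial {F F₁ F₂ : ℝ × ℝ → ℂ} (h₁ : Continuous F₁) (h₂ : Continuous F₂)
    (hd₁ : ∀ x y, HasDerivAt (fun s => F (s, y)) (F₁ (x, y)) x)
    (hd₂ : ∀ x y, HasDerivAt (fun s => F (x, s)) (F₂ (x, y)) y) : ContDiff ℝ 1 F := by
  rw [contDiff_one_iff_hasFDerivAt]
  let f₁ : ℝ → ℝ → ℝ →L[ℝ] ℂ := fun x y => ContinuousLinearMap.toSpanSingleton ℝ (F₁ (x, y))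
  let f₂ : ℝ → ℝ → ℝ →L[ℝ] ℂ := fun x y => ContinuousLinearMap.toSpanSingleton ℝ (F₂ (x, y))
  have c₁ : Continuous (Function.uncurry f₁) := continuous_clm_apply.2 fun y => by
    simp only [f₁, Function.uncurry_def, ContinuousLinearMap.toSpanSingleton_apply]
    fun_prop
  have c₂ : Continuous (Function.uncurry f₂) := continuous_clm_apply.2 fun y => by
    simp only [f₂, Function.uncurry_def, ContinuousLinearMap.toSpanSingleton_apply]
    fun_prop
  refine ⟨fun z => (f₁ z.1 z.2).coprod (f₂ z.1 z.2), ?_, fun z => ?_⟩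
  · refine continuous_clm_apply.2 fun y => ?_
    simp only [f₁, f₂, ContinuousLinearMap.coprod_apply, ContinuousLinearMap.toSpanSingleton_apply]
    fun_prop
  · exact (hasStrictFDerivAt_uncurry_coprod (f := fun x y => F (x, y)) (f₁ := f₁) (f₂ := f₂)
      (Eventually.of_forall fun v => (hd₁ v.1 v.2).hasFDerivAt)
      (Eventually.of_forall fun v => (hd₂ v.1 v.2).hasFDerivAt)
      c₁.continuousAt c₂.continuousAt).hasFDerivAt

/-- Differentiate the integral equation in each variable. The derivative `R = ∂H/∂ξ` contains `Q ξ /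
2` and need not be differentiable in `ξ`, whereas `P = ∂H/∂η` is an integral in `ξ`, so the mixed
derivative exists in this order. -/
theorem exists_isCharacteristicSolution {Q : ℝ → ℂ} (hQ : Continuous Q) {M : ℝ}
    (hM : ∀ x, ‖Q x‖ ≤ M) : ∃ H P, IsCharacteristicSolution Q H P := by
  obtain ⟨H, hH, hint⟩ := exists_goursat_integral_equation hQ hM
  let P : ℝ × ℝ → ℂ := fun z => ∫ α in (0 : ℝ)..z.1, Q (α + z.2) * H (α, z.2)
  let R : ℝ × ℝ → ℂ := fun z => 1 / 2 * Q z.1 + ∫ β in (0 : ℝ)..z.2, Q (z.1 + β) * H (z.1, β)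
  have hP : Continuous P := intervalIntegral.continuous_parametric_intervalIntegral_of_continuous
    (f := fun (z : ℝ × ℝ) α => Q (α + z.2) * H (α, z.2))
    (by simp only [Function.uncurry_def]; fun_prop) continuous_fst
  have hR' : Continuous fun z : ℝ × ℝ => ∫ β in (0 : ℝ)..z.2, Q (z.1 + β) * H (z.1, β) :=
    intervalIntegral.continuous_parametric_intervalIntegral_of_continuous
      (f := fun (z : ℝ × ℝ) β => Q (z.1 + β) * H (z.1, β))
      (by simp only [Function.uncurry_def]; fun_prop) continuous_snd
  have hR : Continuous R := by fun_prop
  have hd₂ : ∀ ξ η, HasDerivAt (fun s => H (ξ, s)) (P (ξ, η)) η := by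
    intro ξ η
    rw [funext fun s => hint ξ s]
    have hc : Continuous fun β => P (ξ, β) := by fun_prop
    exact (hc.integral_hasStrictDerivAt 0 η).hasDerivAt.const_add _
  have hd₁ : ∀ ξ η, HasDerivAt (fun s => H (s, η)) (R (ξ, η)) ξ := by
    intro ξ η
    -- Fubini moves the variable `ξ` to the outer limit of integration.
    have e : ∀ s, H (s, η) = 1 / 2 * (∫ x in (0 : ℝ)..s, Q x) +
        ∫ α in (0 : ℝ)..s, ∫ β in (0 : ℝ)..η, Q (α + β) * H (α, β) := by
      intro s
      rw [hint, intervalIntegral_intervalIntegral_swap]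
      have hc : Continuous (Function.uncurry fun β α => Q (α + β) * H (α, β)) := by
        simp only [Function.uncurry_def]; fun_prop
      exact (hc.continuousOn.integrableOn_compact (isCompact_uIcc.prod isCompact_uIcc)).mono_set
        (prod_mono uIoc_subset_uIcc uIoc_subset_uIcc)
    rw [funext e]
    have hc : Continuous fun α => ∫ β in (0 : ℝ)..η, Q (α + β) * H (α, β) :=
      hR'.comp (by fun_prop : Continuous fun α : ℝ => (α, η))
    exact ((hQ.integral_hasStrictDerivAt 0 ξ).hasDerivAt.const_mul _).add
      (hc.integral_hasStrictDerivAt 0 ξ).hasDerivAt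
  refine ⟨H, P, contDiff_one_of_partial hR hP hd₁ hd₂, hP, hd₂, fun ξ η => ?_, fun ξ => ?_,
    fun η => ?_, fun η => ?_⟩
  · have hc : Continuous fun α => Q (α + η) * H (α, η) := by fun_prop
    exact (hc.integral_hasStrictDerivAt 0 ξ).hasDerivAt
  · rw [hint]; simp
  · rw [hint]; simp
  · simp [P]

/-- The function `H` of the characteristic coordinates as a function of `x` and `t`. -/
def ofCharacteristic (H : ℝ × ℝ → ℂ) (z : ℝ × ℝ) : ℂ :=
  H ((z.1 + z.2) / 2, (z.1 - z.2) / 2)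

namespace IsCharacteristicSolution

variable {Q : ℝ → ℂ} {H P : ℝ × ℝ → ℂ}

theorem continuous (hH : IsCharacteristicSolution Q H P) : Continuous H :=
  hH.contDiff.continuous

theorem contDiff_ofCharacteristic (hH : IsCharacteristicSolution Q H P) :
    ContDiff ℝ 1 (ofCharacteristic H) :=
  hH.contDiff.comp (by fun_prop)

/-- Moving along `(1, -1)` fixes `ξ = (x + t) / 2` and moves `η = (x - t) / 2` at unit speed. -/
theorem fderiv_ofCharacteristic (hH : IsCharacteristicSolution Q H P) (z : ℝ × ℝ) :
    fderiv ℝ (ofCharacteristic H) z (1, -1) = ofCharacteristic P z := by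
  have h1 : HasDerivAt (fun s : ℝ => ofCharacteristic H (z + s • (1, -1)))
      (fderiv ℝ (ofCharacteristic H) z (1, -1)) 0 :=
    ((hH.contDiff_ofCharacteristic.differentiable (by norm_num) z).hasFDerivAt.hasLineDerivAt _)
  have h2 : HasDerivAt (fun s : ℝ => ofCharacteristic H (z + s • (1, -1)))
      (ofCharacteristic P z) 0 := by
    have h3 := (hH.hasDerivAt_snd ((z.1 + z.2) / 2) ((z.1 - z.2) / 2 + 0)).comp_const_add
      ((z.1 - z.2) / 2) 0
    rw [add_zero] at h3
    refine h3.congr_of_eventuallyEq (Eventually.of_forall fun s => ?_)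
    simp only [ofCharacteristic, Prod.fst_add, Prod.snd_add, Prod.smul_mk, smul_eq_mul]
    congr 2 <;> ring
  exact h1.unique h2

theorem hasLineDerivAt_ofCharacteristic (hH : IsCharacteristicSolution Q H P) (x t : ℝ) :
    HasLineDerivAt ℝ (fun z : ℝ × ℝ => fderiv ℝ (ofCharacteristic H) z (1, -1))
      (Q x * ofCharacteristic H (x, t)) (x, t) (1, 1) := by
  simp only [hH.fderiv_ofCharacteristic]
  have h3 := (hH.hasDerivAt_fst ((x + t) / 2 + 0) ((x - t) / 2)).comp_const_add
      ((x + t) / 2) 0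
  rw [add_zero, show (x + t) / 2 + (x - t) / 2 = x by ring] at h3
  refine HasDerivAt.congr_of_eventuallyEq h3 (Eventually.of_forall fun s => ?_)
  simp only [ofCharacteristic, Prod.fst_add, Prod.snd_add, Prod.smul_mk, smul_eq_mul]
  congr 2 <;> ring

/-- The diagonal is the axis `η = 0` and the antidiagonal is `ξ = 0`. The two potentials need agree
only on `[-b, b]`, so `Q` may be extended to the line. -/
theorem isGoursatSolution (hH : IsCharacteristicSolution Q H P) {Q' : ℝ → ℂ} {b : ℝ}
    (hQ : EqOn Q' Q (Icc (-b) b)) : IsGoursatSolution Q' b (ofCharacteristic H) where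
  continuousOn := hH.contDiff_ofCharacteristic.continuous.continuousOn
  contDiffOn := hH.contDiff_ofCharacteristic.contDiffOn
  equation x hx t _ := by
    rw [hQ (Ioo_subset_Icc_self hx)]
    exact hH.hasLineDerivAt_ofCharacteristic x t
  diagonal x hx := by
    simp only [ofCharacteristic, sub_self, zero_div, add_self_div_two, hH.fst_axis]
    congr 1
    refine intervalIntegral.integral_congr fun s hs => (hQ ?_).symm
    have h0 : (0 : ℝ) ∈ Icc (-b) b := by constructor <;> linarith [hx.1, hx.2]
    exact uIcc_subset_Icc h0 hx hs
  antidiagonal x _ := by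
    simp [ofCharacteristic, hH.snd_axis]

end IsCharacteristicSolution

/-! ### Uniqueness for the Goursat problem -/

/-- Uniqueness for the homogeneous Goursat problem. -/
theorem eqOn_zero_of_goursat {Q : ℝ → ℂ} {b : ℝ} (hb : 0 < b) (hQ : ContinuousOn Q (Icc (-b) b))
    {E : ℝ × ℝ → ℂ} (hE : ContinuousOn E (Icc (-b) b ×ˢ Icc (-b) b))
    (hE1 : ContDiffOn ℝ 1 E (Ioo (-b) b ×ˢ Ioo (-b) b))
    (heq : ∀ x ∈ Ioo (-b) b, ∀ t ∈ Ioo (-b) b,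
      HasLineDerivAt ℝ (fun z : ℝ × ℝ => fderiv ℝ E z (1, -1)) (Q x * E (x, t)) (x, t) (1, 1))
    (hd : ∀ x ∈ Icc (-b) b, E (x, x) = 0) (ha : ∀ x ∈ Icc (-b) b, E (x, -x) = 0) :
    EqOn E 0 (Icc (-b) b ×ˢ Icc (-b) b) := by
  have hsq : Icc (-b) b ×ˢ Icc (-b) b = closure (Ioo (-b) b ×ˢ Ioo (-b) b) := by
    rw [closure_prod_eq, closure_Ioo (by linarith)]
  obtain ⟨M, hM⟩ := isCompact_Icc.exists_bound_of_continuousOn hQ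
  obtain ⟨N, hN⟩ := (isCompact_Icc.prod isCompact_Icc).exists_bound_of_continuousOn hE
  have h0 : (0 : ℝ) ∈ Icc (-b) b := by constructor <;> linarith
  have hM0 : 0 ≤ M := (norm_nonneg _).trans (hM 0 h0)
  have hN0 : 0 ≤ N := (norm_nonneg _).trans (hN (0, 0) ⟨h0, h0⟩)
  -- The open square in characteristic coordinates. With a point it contains the rectangle spanned
  -- by that point and the origin, so one can integrate from the axes without leaving `D`.
  let D : Set (ℝ × ℝ) := {z | |z.1| + |z.2| < b}
  have hmem : ∀ z ∈ D, z.1 + z.2 ∈ Ioo (-b) b ∧ z.1 - z.2 ∈ Ioo (-b) b := by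
    intro z hz
    have hz' : |z.1| + |z.2| < b := hz
    have h1 := abs_lt.1 ((abs_add_le z.1 z.2).trans_lt hz')
    have h2 := abs_lt.1 ((abs_sub z.1 z.2).trans_lt hz')
    exact ⟨h1, h2⟩
  have hDmono : ∀ ξ η α β, (ξ, η) ∈ D → α ∈ uIcc 0 ξ → β ∈ uIcc 0 η → (α, β) ∈ D := by
    intro ξ η α β hz hα hβ
    have h1 := abs_sub_left_of_mem_uIcc hα
    have h2 := abs_sub_left_of_mem_uIcc hβ
    simp only [sub_zero] at h1 h2
    have hz' : |ξ| + |η| < b := hz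
    exact (add_le_add h1 h2).trans_lt hz'
  have hopen : IsOpen (Ioo (-b) b ×ˢ Ioo (-b) b : Set (ℝ × ℝ)) := isOpen_Ioo.prod isOpen_Ioo
  let F : ℝ × ℝ → ℂ := fun z => E (z.1 + z.2, z.1 - z.2)
  let G : ℝ × ℝ → ℂ := fun z => fderiv ℝ E (z.1 + z.2, z.1 - z.2) (1, -1)
  have hF2 : ∀ z ∈ D, HasDerivAt (fun s => F (z.1, s)) (G z) z.2 := by
    intro z hz
    have hdE : HasFDerivAt E (fderiv ℝ E (z.1 + z.2, z.1 - z.2)) (z.1 + z.2, z.1 - z.2) :=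
      ((hE1.contDiffAt (hopen.mem_nhds (hmem z hz))).differentiableAt (by norm_num)).hasFDerivAt
    exact hdE.comp_hasDerivAt (f := fun s : ℝ => (z.1 + s, z.1 - s)) z.2
      (((hasDerivAt_id z.2).const_add z.1).prodMk ((hasDerivAt_id z.2).const_sub z.1))
  have hG1 : ∀ z ∈ D, HasDerivAt (fun s => G (s, z.2)) (Q (z.1 + z.2) * F z) z.1 := by
    intro z hz
    have h1 : HasDerivAt _ _ _ := heq _ (hmem z hz).1 _ (hmem z hz).2
    have h2 : HasDerivAt (fun s : ℝ => s - z.1) 1 z.1 := (hasDerivAt_id z.1).sub_const _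
    have h3 := HasDerivAt.scomp (h := fun s : ℝ => s - z.1) z.1 (by rw [sub_self]; exact h1) h2
    rw [one_smul] at h3
    refine h3.congr_of_eventuallyEq (Eventually.of_forall fun s => ?_)
    simp only [G, Function.comp_apply, Prod.mk_add_mk, Prod.smul_mk, smul_eq_mul]
    congr 3 <;> ring
  have hGc : ContinuousOn G D := by
    have h1 : ContinuousOn (fun z => fderiv ℝ E z (1, -1)) (Ioo (-b) b ×ˢ Ioo (-b) b) :=
      (hE1.continuousOn_fderiv_of_isOpen hopen le_rfl).clm_apply continuousOn_const
    exact h1.comp (by fun_prop) hmem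
  have hQF : ContinuousOn (fun z : ℝ × ℝ => Q (z.1 + z.2) * F z) D := by
    refine (hQ.comp (by fun_prop) fun z hz => Ioo_subset_Icc_self (hmem z hz).1).mul
      (hE.comp (by fun_prop) fun z hz => ⟨Ioo_subset_Icc_self (hmem z hz).1,
        Ioo_subset_Icc_self (hmem z hz).2⟩)
  have hG0 : ∀ η, (0, η) ∈ D → G (0, η) = 0 := by
    intro η hη
    have h1 : HasDerivAt (fun s => F (0, s)) 0 η := by
      refine (hasDerivAt_const η (0 : ℂ)).congr_of_eventuallyEq ?_
      have : |η| < b := by simpa [D] using hη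
      filter_upwards [isOpen_Ioo.mem_nhds (abs_lt.1 this)] with s hs
      simpa [F] using ha s (Ioo_subset_Icc_self hs)
    exact (hF2 _ hη).unique h1
  have hF0 : ∀ ξ, (ξ, 0) ∈ D → F (ξ, 0) = 0 := by
    intro ξ hξ
    have : |ξ| < b := by simpa [D] using hξ
    simpa [F] using hd ξ (Ioo_subset_Icc_self (abs_lt.1 this))
  have hGi : ∀ z ∈ D, G z = ∫ α in (0 : ℝ)..z.1, Q (α + z.2) * F (α, z.2) := by
    intro z hz
    have hm : ∀ α ∈ uIcc 0 z.1, (α, z.2) ∈ D := fun α hα => hDmono _ _ _ _ hz hα right_mem_uIcc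
    rw [intervalIntegral.integral_eq_sub_of_hasDerivAt (f := fun s => G (s, z.2))
      (fun α hα => hG1 (α, z.2) (hm α hα)), hG0 _ (hm 0 left_mem_uIcc), sub_zero]
    exact (hQF.comp (f := fun α : ℝ => (α, z.2)) (by fun_prop) hm).intervalIntegrable
  have hFi : ∀ z ∈ D, F z = ∫ β in (0 : ℝ)..z.2, G (z.1, β) := by
    intro z hz
    have hm : ∀ β ∈ uIcc 0 z.2, (z.1, β) ∈ D := fun β hβ => hDmono _ _ _ _ hz right_mem_uIcc hβ
    rw [intervalIntegral.integral_eq_sub_of_hasDerivAt (f := fun s => F (z.1, s))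
      (fun β hβ => hF2 (z.1, β) (hm β hβ)), hF0 _ (hm 0 left_mem_uIcc), sub_zero]
    exact (hGc.comp (f := fun β : ℝ => (z.1, β)) (by fun_prop) hm).intervalIntegrable
  -- One pass through the integral equation multiplies the weighted bound by `M / (M + 1) ^ 2 < 1`;
  -- iterating from the bound `N` forces `F = 0`.
  have hstep : ∀ C, 0 ≤ C → (∀ z ∈ D, ‖F z‖ ≤ C * Real.exp ((M + 1) * |z.1| + (M + 1) * |z.2|)) →
      ∀ z ∈ D, ‖F z‖ ≤ M / (M + 1) ^ 2 * C * Real.exp ((M + 1) * |z.1| + (M + 1) * |z.2|) := by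
    intro C hC h z hz
    have e : F z = ∫ β in (0 : ℝ)..z.2, ∫ α in (0 : ℝ)..z.1, Q (α + β) * F (α, β) := by
      rw [hFi z hz]
      exact intervalIntegral.integral_congr fun β hβ =>
        hGi (z.1, β) (hDmono _ _ _ _ hz right_mem_uIcc hβ)
    rw [e]
    refine (norm_goursat_integral_le (G := fun z => Q (z.1 + z.2) * F z) (c := M + 1)
      (C := M * C) (by positivity) (by positivity) fun α hα β hβ => ?_).trans_eq (by ring)
    have hm := hDmono _ _ _ _ hz hα hβ
    rw [norm_mul, mul_assoc]
    gcongr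
    · exact hM _ (Ioo_subset_Icc_self (hmem _ hm).1)
    · exact h _ hm
  have hpow : ∀ n : ℕ, ∀ z ∈ D, ‖F z‖ ≤ (M / (M + 1) ^ 2) ^ n * N *
      Real.exp ((M + 1) * |z.1| + (M + 1) * |z.2|) := by
    intro n
    induction n with
    | zero =>
      intro z hz
      rw [pow_zero, one_mul]
      refine (hN _ ⟨Ioo_subset_Icc_self (hmem z hz).1, Ioo_subset_Icc_self (hmem z hz).2⟩).trans ?_
      exact le_mul_of_one_le_right hN0 (Real.one_le_exp (by positivity))
    | succ n ih =>
      intro z hz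
      refine (hstep _ (by positivity) ih z hz).trans_eq ?_
      rw [pow_succ]; ring
  have hF : ∀ z ∈ D, F z = 0 := by
    intro z hz
    have hK : M / (M + 1) ^ 2 < 1 := by
      rw [div_lt_one (by positivity)]
      nlinarith
    have ht := ((tendsto_pow_atTop_nhds_zero_of_lt_one (by positivity) hK).mul_const N).mul_const
      (Real.exp ((M + 1) * |z.1| + (M + 1) * |z.2|))
    rw [zero_mul, zero_mul] at ht
    exact norm_le_zero_iff.1 (ge_of_tendsto' ht fun n => hpow n z hz)
  have hin : EqOn E 0 (Ioo (-b) b ×ˢ Ioo (-b) b) := by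
    rintro ⟨x, t⟩ ⟨hx, ht⟩
    have hz : ((x + t) / 2, (x - t) / 2) ∈ D := by
      have hx' : |x| < b := abs_lt.2 hx
      have ht' : |t| < b := abs_lt.2 ht
      simp only [D, mem_ofPred_eq]
      rw [abs_lt] at hx' ht'
      rcases abs_cases ((x + t) / 2) with h | h <;> rcases abs_cases ((x - t) / 2) with h' | h' <;>
        linarith [hx'.1, hx'.2, ht'.1, ht'.2]
    have := hF _ hz
    simp only [F] at this
    rw [show (x + t) / 2 + (x - t) / 2 = x by ring, show (x + t) / 2 - (x - t) / 2 = t by ring]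
      at this
    exact this
  rw [hsq] at hE ⊢
  exact hin.of_subset_closure hE continuousOn_const subset_closure subset_rfl

theorem IsGoursatSolution.eqOn {Q : ℝ → ℂ} {b : ℝ} (hb : 0 < b)
    (hQ : ContinuousOn Q (Icc (-b) b)) {K K' : ℝ × ℝ → ℂ} (hK : IsGoursatSolution Q b K)
    (hK' : IsGoursatSolution Q b K') : EqOn K' K (Icc (-b) b ×ˢ Icc (-b) b) := by
  have hopen : IsOpen (Ioo (-b) b ×ˢ Ioo (-b) b : Set (ℝ × ℝ)) := isOpen_Ioo.prod isOpen_Ioo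
  have := eqOn_zero_of_goursat hb hQ (E := K' - K) (hK'.continuousOn.sub hK.continuousOn)
    (hK'.contDiffOn.sub hK.contDiffOn) (fun x hx t ht => by
      have h1 : HasDerivAt _ _ _ := (hK'.equation x hx t ht)
      have h2 : HasDerivAt _ _ _ := (hK.equation x hx t ht)
      rw [Pi.sub_apply, mul_sub]
      refine HasDerivAt.congr_of_eventuallyEq (h1.sub h2) ?_
      have hmem : ∀ᶠ s : ℝ in 𝓝 0, (x, t) + s • ((1, 1) : ℝ × ℝ) ∈
          (Ioo (-b) b ×ˢ Ioo (-b) b : Set (ℝ × ℝ)) := by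
        have hc : Continuous fun s : ℝ => (x, t) + s • ((1, 1) : ℝ × ℝ) := by fun_prop
        refine hc.continuousAt.eventually_mem (hopen.mem_nhds ?_)
        simpa using ⟨hx, ht⟩
      filter_upwards [hmem] with s hs
      have d1 := (hK'.contDiffOn.contDiffAt (hopen.mem_nhds hs)).differentiableAt (by norm_num)
      have d2 := (hK.contDiffOn.contDiffAt (hopen.mem_nhds hs)).differentiableAt (by norm_num)
      rw [fderiv_sub d1 d2]
      rfl)
    (fun x hx => by rw [Pi.sub_apply, hK'.diagonal x hx, hK.diagonal x hx, sub_self])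
    (fun x hx => by rw [Pi.sub_apply, hK'.antidiagonal x hx, hK.antidiagonal x hx, sub_self])
  intro z hz
  exact sub_eq_zero.1 (this hz)

/-! ### Invertibility of Volterra operators with symmetric limits -/

/-- `1 +` a Volterra operator with symmetric limits is invertible on `C[-b, b]`. -/
theorem exists_volterra_equiv {b : ℝ} (hb : -b ≤ b) {k : ℝ × ℝ → ℂ} (hk : Continuous k) :
    ∃ T : C(Icc (-b) b, ℂ) ≃L[ℂ] C(Icc (-b) b, ℂ), ∀ (u : C(Icc (-b) b, ℂ)) (x : Icc (-b) b),
      T u x = u x + ∫ t in (-(x : ℝ))..(x : ℝ), k (x, t) * IccExtend hb u t := by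
  obtain ⟨M, hM⟩ := ((isCompact_Icc (a := -b) (b := b)).prod
    (isCompact_Icc (a := -b) (b := b))).exists_bound_of_continuousOn hk.continuousOn
  have h0 : (0 : ℝ) ∈ Icc (-b) b := by constructor <;> linarith
  have hM0 : 0 ≤ M := (norm_nonneg _).trans (hM (0, 0) ⟨h0, h0⟩)
  have hext : ∀ u : C(Icc (-b) b, ℂ), Continuous (IccExtend hb u) := fun u =>
    u.continuous.Icc_extend'
  have hint : ∀ (u : C(Icc (-b) b, ℂ)) (x : ℝ), Continuous fun t => k (x, t) * IccExtend hb u t :=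
    fun u x => by have := hext u; fun_prop
  have hcont : ∀ u : C(Icc (-b) b, ℂ), Continuous fun x : Icc (-b) b =>
      ∫ t in (-(x : ℝ))..(x : ℝ), k (x, t) * IccExtend hb u t := by
    intro u
    have he := hext u
    have hF : Continuous (Function.uncurry fun (x : Icc (-b) b) (t : ℝ) =>
        k ((x : ℝ), t) * IccExtend hb u t) := by
      simp only [Function.uncurry_def]; fun_prop
    have := (intervalIntegral.continuous_parametric_intervalIntegral_of_continuous (μ := volume)
      (a₀ := 0) hF continuous_subtype_val).sub
      (intervalIntegral.continuous_parametric_intervalIntegral_of_continuous (μ := volume)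
      (a₀ := 0) hF (continuous_subtype_val.neg))
    refine this.congr fun x => ?_
    exact intervalIntegral.integral_interval_sub_left ((hint u x).intervalIntegrable _ _)
      ((hint u x).intervalIntegrable _ _)
  -- The integrals over `[0, x]` and `[-x, 0]` contribute `M / c` each, so the contraction constant
  -- is `2 * M / c < 1`.
  set c : ℝ := 2 * M + 1 with hcdef
  have hc : 0 < c := by positivity
  have hbound : ∀ (u : C(Icc (-b) b, ℂ)) (C : ℝ), 0 ≤ C →
      (∀ x : Icc (-b) b, ‖u x‖ ≤ C * Real.exp (c * |(x : ℝ)|)) → ∀ x : Icc (-b) b,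
      ‖∫ t in (-(x : ℝ))..(x : ℝ), k (x, t) * IccExtend hb u t‖
        ≤ C * (2 * M / c) * Real.exp (c * |(x : ℝ)|) := by
    intro u C hC hu x
    have key : ∀ y ∈ Icc (-b) b, ‖∫ t in (0 : ℝ)..y, k (x, t) * IccExtend hb u t‖
        ≤ (M * C) / c * Real.exp (c * |y|) := by
      intro y hy
      refine norm_integral_le_exp_mul_abs hc (by positivity) fun s hs => ?_
      have hs' : s ∈ Icc (-b) b := uIcc_subset_Icc h0 hy hs
      rw [norm_mul, IccExtend_of_mem _ _ hs', mul_assoc]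
      gcongr
      · exact hM _ ⟨x.2, hs'⟩
      · exact hu ⟨s, hs'⟩
    have h1 := key x x.2
    have h2 := key (-x) ⟨by linarith [x.2.2], by linarith [x.2.1]⟩
    rw [abs_neg] at h2
    rw [← intervalIntegral.integral_interval_sub_left ((hint u x).intervalIntegrable 0 x)
      ((hint u x).intervalIntegrable 0 (-x))]
    refine (norm_sub_le _ _).trans ((add_le_add h1 h2).trans_eq ?_)
    ring
  let V : C(Icc (-b) b, ℂ) →L[ℂ] C(Icc (-b) b, ℂ) := LinearMap.mkContinuous
    { toFun := fun u => ⟨_, hcont u⟩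
      map_add' := fun u v => by
        ext x
        simp only [ContinuousMap.coe_mk, ContinuousMap.add_apply]
        rw [← intervalIntegral.integral_add ((hint u x).intervalIntegrable _ _)
          ((hint v x).intervalIntegrable _ _)]
        refine intervalIntegral.integral_congr fun t _ => ?_
        simp only [IccExtend, Function.comp_apply, ContinuousMap.add_apply]
        ring
      map_smul' := fun a u => by
        ext x
        simp only [ContinuousMap.coe_mk, ContinuousMap.smul_apply, RingHom.id_apply, smul_eq_mul]
        rw [← intervalIntegral.integral_const_mul]
        refine intervalIntegral.integral_congr fun t _ => ?_
        simp only [IccExtend, Function.comp_apply, ContinuousMap.smul_apply, smul_eq_mul]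
        ring }
    (2 * M / c * Real.exp (c * b)) (fun u => by
      rw [ContinuousMap.norm_le _ (by positivity)]
      intro x
      refine (hbound u ‖u‖ (norm_nonneg _) (fun y => (u.norm_coe_le_norm y).trans ?_) x).trans ?_
      · exact le_mul_of_one_le_right (norm_nonneg _)
          (Real.one_le_exp (mul_nonneg hc.le (abs_nonneg _)))
      · rw [mul_assoc, mul_comm ‖u‖]
        gcongr
        exact abs_le.2 x.2)
  have hunit : IsUnit (1 + V) := by
    refine isUnit_one_add_of_exp_weight V ⟨fun x => c * |(x : ℝ)|, by fun_prop⟩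
      (c := 2 * M / c) (by positivity) ?_ hbound
    rw [div_lt_one hc]
    linarith
  obtain ⟨U, hU⟩ := hunit
  refine ⟨ContinuousLinearEquiv.ofUnit U, fun u x => ?_⟩
  change (U : C(Icc (-b) b, ℂ) →L[ℂ] C(Icc (-b) b, ℂ)) u x = _
  rw [hU]
  rfl

/-! ### The intertwining relation for the Goursat kernel -/

/-- `∫_{-x}^x K(x, t) u(t) dt` for `K = ofCharacteristic H`, in characteristic coordinates. -/
def charIntegral (H : ℝ × ℝ → ℂ) (u : ℝ → ℂ) (x : ℝ) : ℂ :=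
  2 * ∫ s in (0 : ℝ)..x, H (s, x - s) * u (2 * s - x)

theorem charIntegral_eq (H : ℝ × ℝ → ℂ) (u : ℝ → ℂ) (x : ℝ) :
    charIntegral H u x = ∫ t in (-x)..x, ofCharacteristic H (x, t) * u t := by
  have := intervalIntegral.smul_integral_comp_mul_sub (a := 0) (b := x)
    (fun t => ofCharacteristic H (x, t) * u t) 2 x
  rw [show 2 * 0 - x = -x by ring, show 2 * x - x = x by ring] at this
  rw [← this, charIntegral, Complex.real_smul]
  push_cast
  congr 1
  refine intervalIntegral.integral_congr fun s _ => ?_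
  simp only [ofCharacteristic]
  congr 3 <;> ring

/-- The substitution `s ↦ x - s` moves the parameter `x` from the slot `η` to the slot `ξ`. The
first form suits `∂H/∂η = P`, this one suits `∂P/∂ξ = Q H`. -/
theorem charIntegral_eq_reflect (H : ℝ × ℝ → ℂ) (u : ℝ → ℂ) (x : ℝ) :
    charIntegral H u x = 2 * ∫ s in (0 : ℝ)..x, H (x - s, s) * u (x - 2 * s) := by
  have := intervalIntegral.integral_comp_sub_left (a := 0) (b := x)
    (fun s => H (s, x - s) * u (2 * s - x)) x
  rw [sub_self, sub_zero] at this
  rw [charIntegral, ← this]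
  congr 1
  refine intervalIntegral.integral_congr fun s _ => ?_
  simp only [sub_sub_cancel]
  congr 2
  ring

namespace IsCharacteristicSolution

variable {Q : ℝ → ℂ} {H P : ℝ × ℝ → ℂ}

/-- The boundary term at `s = x` is `2 H(x, 0) u(x)`, given by the data on the diagonal. -/
theorem hasDerivAt_charIntegral (hH : IsCharacteristicSolution Q H P) {u u' : ℝ → ℂ}
    (hu : ∀ x, HasDerivAt u (u' x) x) (hu' : Continuous u') (x : ℝ) :
    HasDerivAt (charIntegral H u)
      ((∫ s in (0 : ℝ)..x, Q s) * u x + charIntegral P u x - charIntegral H u' x) x := by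
  have hc := hH.continuous
  have hcP := hH.continuous_deriv
  have hcu : Continuous u := continuous_iff_continuousAt.2 fun x => (hu x).continuousAt
  have hc1 : Continuous fun s => P (s, x - s) * u (2 * s - x) := by fun_prop
  have hc2 : Continuous fun s => H (s, x - s) * u' (2 * s - x) := by fun_prop
  have h1 := (hasDerivAt_integral_diagonal (F := fun y s => H (s, y - s) * u (2 * s - y))
    (F' := fun y s => P (s, y - s) * u (2 * s - y) - H (s, y - s) * u' (2 * s - y))
    (by simp only [Function.uncurry_def]; fun_prop) (by simp only [Function.uncurry_def]; fun_prop)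
    (fun y s => by
      have d1 := (hH.hasDerivAt_snd s (y - s)).comp_sub_const y s
      have d2 := (hu (2 * s - y)).comp_const_sub (2 * s) y
      refine (d1.mul d2).congr_deriv ?_
      ring) x).const_mul 2
  refine h1.congr_deriv ?_
  rw [intervalIntegral.integral_sub (hc1.intervalIntegrable _ _) (hc2.intervalIntegrable _ _),
    charIntegral, charIntegral, sub_self, hH.fst_axis, show 2 * x - x = x by ring]
  ring

/-- In the reflected form `Q` is evaluated at `(x - s) + s = x` and leaves the integral; the
boundary term vanishes because `P(0, x) = 0`. -/
theorem hasDerivAt_charIntegral_deriv (hH : IsCharacteristicSolution Q H P) (hQ : Continuous Q)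
    {u u' : ℝ → ℂ} (hu : ∀ x, HasDerivAt u (u' x) x) (hu' : Continuous u') (x : ℝ) :
    HasDerivAt (charIntegral P u) (Q x * charIntegral H u x + charIntegral P u' x) x := by
  have hc := hH.continuous
  have hcP := hH.continuous_deriv
  have hcu : Continuous u := continuous_iff_continuousAt.2 fun x => (hu x).continuousAt
  have hc1 : Continuous fun s => Q x * (H (x - s, s) * u (x - 2 * s)) := by fun_prop
  have hc2 : Continuous fun s => P (x - s, s) * u' (x - 2 * s) := by fun_prop
  have h1 := (hasDerivAt_integral_diagonal (F := fun y s => P (y - s, s) * u (y - 2 * s))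
    (F' := fun y s => Q y * (H (y - s, s) * u (y - 2 * s)) + P (y - s, s) * u' (y - 2 * s))
    (by simp only [Function.uncurry_def]; fun_prop) (by simp only [Function.uncurry_def]; fun_prop)
    (fun y s => by
      have d1 := (hH.hasDerivAt_fst (y - s) s).comp_sub_const y s
      have d2 := (hu (y - 2 * s)).comp_sub_const y (2 * s)
      refine (d1.mul d2).congr_deriv ?_
      rw [sub_add_cancel]
      ring) x).const_mul 2
  rw [funext (charIntegral_eq_reflect P u)]
  refine h1.congr_deriv ?_
  rw [intervalIntegral.integral_add (hc1.intervalIntegrable _ _) (hc2.intervalIntegrable _ _),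
    charIntegral_eq_reflect, charIntegral_eq_reflect, sub_self, hH.deriv_snd_axis,
    intervalIntegral.integral_const_mul]
  ring

/-- The operator `1 + ∫_{-x}^x K(x, t) · dt` intertwines `d²/dx²` and `d²/dx² - Q`. -/
theorem hasDerivAt_transmutation (hH : IsCharacteristicSolution Q H P) (hQ : Continuous Q)
    {u u₁ u₂ : ℝ → ℂ} (hu : ∀ x, HasDerivAt u (u₁ x) x) (hu₁ : ∀ x, HasDerivAt u₁ (u₂ x) x)
    (hu₂ : Continuous u₂) :
    ∃ g₁ : ℝ → ℂ, g₁ 0 = u₁ 0 ∧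
      (∀ x, HasDerivAt (fun y => u y + charIntegral H u y) (g₁ x) x) ∧
      ∀ x, HasDerivAt g₁
        (Q x * (u x + charIntegral H u x) + (u₂ x + charIntegral H u₂ x)) x := by
  have hcu₁ : Continuous u₁ := continuous_iff_continuousAt.2 fun x => (hu₁ x).continuousAt
  refine ⟨fun x => u₁ x + ((∫ s in (0 : ℝ)..x, Q s) * u x + charIntegral P u x
    - charIntegral H u₁ x), by simp [charIntegral], fun x =>
      (hu x).add (hH.hasDerivAt_charIntegral hu hcu₁ x), fun x => ?_⟩
  -- The terms `(∫ Q) u₁` and `charIntegral P u₁` each appear twice with opposite signs and cancel.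
  refine ((hu₁ x).add (((((hQ.integral_hasStrictDerivAt 0 x).hasDerivAt).mul (hu x)).add
    (hH.hasDerivAt_charIntegral_deriv hQ hu hcu₁ x)).sub
    (hH.hasDerivAt_charIntegral hu₁ hu₂ x))).congr_deriv ?_
  ring

end IsCharacteristicSolution

/-! ### The factor carrying the parameter `h` -/

/-- `u(x) + (h/2) ∫_{-x}^x u`. -/
def symmIntegral (h : ℂ) (u : ℝ → ℂ) (x : ℝ) : ℂ :=
  u x + ∫ t in (-x)..x, h / 2 * u t

theorem hasDerivAt_integral_symm {u : ℝ → ℂ} (hu : Continuous u) (x : ℝ) :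
    HasDerivAt (fun y => ∫ t in (-y)..y, u t) (u x + u (-x)) x := by
  have h1 := (hu.integral_hasStrictDerivAt 0 x).hasDerivAt
  have h2 := (hu.integral_hasStrictDerivAt 0 (-x)).hasDerivAt.scomp x (hasDerivAt_neg x)
  refine ((h1.sub h2).congr_deriv (by simp)).congr_of_eventuallyEq
    (Eventually.of_forall fun y => ?_)
  exact (intervalIntegral.integral_interval_sub_left (hu.intervalIntegrable _ _)
    (hu.intervalIntegrable _ _)).symm

/-- Differentiating twice leaves `u₂ x + (h/2) (u₁ x - u₁ (-x))`, and the difference is `∫_{-x}^x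
u₂`. So this factor commutes with `d²/dx²`. -/
theorem hasDerivAt_symmIntegral (h : ℂ) {u u₁ u₂ : ℝ → ℂ} (hu : ∀ x, HasDerivAt u (u₁ x) x)
    (hu₁ : ∀ x, HasDerivAt u₁ (u₂ x) x) (hu₂ : Continuous u₂) :
    (∀ x, HasDerivAt (symmIntegral h u) (u₁ x + h / 2 * (u x + u (-x))) x) ∧
      ∀ x, HasDerivAt (fun x => u₁ x + h / 2 * (u x + u (-x))) (symmIntegral h u₂ x) x := by
  have hcu : Continuous u := continuous_iff_continuousAt.2 fun x => (hu x).continuousAt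
  refine ⟨fun x => ?_, fun x => ?_⟩
  · refine ((hu x).add (hasDerivAt_integral_symm (hcu.const_mul (h / 2)) x)).congr_deriv ?_
    ring
  · have h2 := (hu (-x)).scomp x (hasDerivAt_neg x)
    refine ((hu₁ x).add (((hu x).add h2).const_mul (h / 2))).congr_deriv ?_
    rw [symmIntegral, intervalIntegral.integral_const_mul,
      intervalIntegral.integral_eq_sub_of_hasDerivAt (fun t _ => hu₁ t)
        (hu₂.intervalIntegrable _ _), neg_one_smul]
    ring

theorem continuous_symmIntegral (h : ℂ) {u : ℝ → ℂ} (hu : Continuous u) :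
    Continuous (symmIntegral h u) :=
  hu.add (continuous_iff_continuousAt.2 fun x =>
    (hasDerivAt_integral_symm (hu.const_mul (h / 2)) x).continuousAt)

/-- Integrate by parts with a primitive `V` of `v`. The boundary terms vanish: at `t = x` the inner
integral is empty, at `t = -x` its integrand is odd over a symmetric interval. Then `t ↦ -t` gathers
`V t - V (-t)`. -/
theorem integral_integral_odd_mul {k v : ℝ → ℂ} (hk : Continuous k) (hv : Continuous v) (x : ℝ) :
    ∫ t in (-x)..x, (∫ s in t..x, (k s - k (-s))) * v t =
      ∫ t in (-x)..x, k t * ∫ s in (-t)..t, v s := by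
  set V : ℝ → ℂ := fun t => ∫ s in (0 : ℝ)..t, v s with hV
  have hdV : ∀ t, HasDerivAt V (v t) t := fun t => (hv.integral_hasStrictDerivAt 0 t).hasDerivAt
  have hcV : Continuous V := continuous_iff_continuousAt.2 fun x => (hdV x).continuousAt
  have hκ : Continuous fun s => k s - k (-s) := by fun_prop
  have hdF : ∀ t, HasDerivAt (fun t => ∫ s in t..x, (k s - k (-s))) (-(k t - k (-t))) t :=
    fun t => intervalIntegral.integral_hasDerivAt_left (hκ.intervalIntegrable _ _)
      (hκ.stronglyMeasurableAtFilter _ _) hκ.continuousAt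
  have hzero : ∫ s in (-x)..x, (k s - k (-s)) = 0 := by
    have hk' : Continuous fun s => k (-s) := by fun_prop
    rw [intervalIntegral.integral_sub (hk.intervalIntegrable _ _) (hk'.intervalIntegrable _ _),
      intervalIntegral.integral_comp_neg, neg_neg, sub_self]
  rw [intervalIntegral.integral_mul_deriv_eq_deriv_mul (fun t _ => hdF t) (fun t _ => hdV t)
    (hκ.neg.intervalIntegrable _ _) (hv.intervalIntegrable _ _), hzero,
    intervalIntegral.integral_same, zero_mul, zero_mul, sub_zero, zero_sub,
    ← intervalIntegral.integral_neg]
  have e1 : ∀ t, -(-(k t - k (-t)) * V t) = k t * V t - k (-t) * V t := fun t => by ring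
  have c1 : Continuous fun t => k t * V t := by fun_prop
  have c2 : Continuous fun t => k (-t) * V t := by fun_prop
  have c3 : Continuous fun t => k t * V (-t) := by fun_prop
  have e2 : ∫ t in (-x)..x, k (-t) * V t = ∫ t in (-x)..x, k t * V (-t) := by
    have := intervalIntegral.integral_comp_neg (a := -x) (b := x) fun t => k t * V (-t)
    simpa using this
  simp only [e1]
  rw [intervalIntegral.integral_sub (c1.intervalIntegrable _ _) (c2.intervalIntegrable _ _), e2,
    ← intervalIntegral.integral_sub (c1.intervalIntegrable _ _) (c3.intervalIntegrable _ _)]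
  refine intervalIntegral.integral_congr fun t _ => ?_
  rw [← mul_sub]
  rw [intervalIntegral.integral_interval_sub_left (hv.intervalIntegrable _ _)
    (hv.intervalIntegrable _ _)]

/-- The operator with kernel `𝐊(x, t; h)` is the composition of two simpler operators. -/
theorem integral_kernelH_mul {H : ℝ × ℝ → ℂ} (hH : Continuous H) (h : ℂ) {u : ℝ → ℂ}
    (hu : Continuous u) (x : ℝ) :
    u x + ∫ t in (-x)..x, kernelH (ofCharacteristic H) h x t * u t =
      symmIntegral h u x + charIntegral H (symmIntegral h u) x := by
  have hK : Continuous fun t => ofCharacteristic H (x, t) := by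
    unfold ofCharacteristic; fun_prop
  have hκ : Continuous fun s => ofCharacteristic H (x, s) - ofCharacteristic H (x, -s) := by
    unfold ofCharacteristic; fun_prop
  have hF : Continuous fun t => ∫ s in t..x,
      (ofCharacteristic H (x, s) - ofCharacteristic H (x, -s)) :=
    continuous_iff_continuousAt.2 fun t =>
      (intervalIntegral.integral_hasDerivAt_left (hκ.intervalIntegrable _ _)
      (hκ.stronglyMeasurableAtFilter _ _) hκ.continuousAt).continuousAt
  have hs : Continuous fun t => ∫ s in (-t)..t, u s :=
    continuous_iff_continuousAt.2 fun x => (hasDerivAt_integral_symm hu x).continuousAt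
  have c1 : Continuous fun t => h / 2 * u t := by fun_prop
  have c2 : Continuous fun t => ofCharacteristic H (x, t) * u t := by fun_prop
  have c3 : Continuous fun t => h / 2 * ((∫ s in t..x,
      (ofCharacteristic H (x, s) - ofCharacteristic H (x, -s))) * u t) := by fun_prop
  have c4 : Continuous fun t => h / 2 * (ofCharacteristic H (x, t) * ∫ s in (-t)..t, u s) := by
    fun_prop
  have e1 : ∀ t, kernelH (ofCharacteristic H) h x t * u t =
      h / 2 * u t + ofCharacteristic H (x, t) * u t + h / 2 * ((∫ s in t..x,
      (ofCharacteristic H (x, s) - ofCharacteristic H (x, -s))) * u t) := by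
    intro t; rw [kernelH]; ring
  have e2 : ∀ t, ofCharacteristic H (x, t) * symmIntegral h u t =
      ofCharacteristic H (x, t) * u t +
        h / 2 * (ofCharacteristic H (x, t) * ∫ s in (-t)..t, u s) := by
    intro t; rw [symmIntegral, intervalIntegral.integral_const_mul]; ring
  rw [charIntegral_eq]
  simp only [e1, e2]
  rw [intervalIntegral.integral_add ((c1.fun_add c2).intervalIntegrable _ _)
      (c3.intervalIntegrable _ _),
    intervalIntegral.integral_add (c1.intervalIntegrable _ _) (c2.intervalIntegrable _ _),
    intervalIntegral.integral_add (c2.intervalIntegrable _ _) (c4.intervalIntegrable _ _),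
    intervalIntegral.integral_const_mul (h / 2) (fun t => _ * u t),
    integral_integral_odd_mul hK hu, intervalIntegral.integral_const_mul (h / 2) (fun t => _ * _),
    symmIntegral]
  ring

/-! ### Solving `T u = g` through an initial value problem -/

/-- Uniqueness for `g'' = Q g - r` with given initial data. -/
theorem eqOn_of_second_order {b : ℝ} (hb : 0 < b) {Q r : ℝ → ℂ} {M : ℝ} (hM : ∀ x, ‖Q x‖ ≤ M)
    {f f₁ g g₁ : ℝ → ℂ} (hf : ∀ x ∈ Ioo (-b) b, HasDerivAt f (f₁ x) x)
    (hf₁ : ∀ x ∈ Ioo (-b) b, HasDerivAt f₁ (Q x * f x - r x) x)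
    (hg : ∀ x ∈ Ioo (-b) b, HasDerivAt g (g₁ x) x)
    (hg₁ : ∀ x ∈ Ioo (-b) b, HasDerivAt g₁ (Q x * g x - r x) x)
    (h0 : f 0 = g 0) (h1 : f₁ 0 = g₁ 0) : EqOn f g (Ioo (-b) b) := by
  have hM0 : 0 ≤ M := (norm_nonneg _).trans (hM 0)
  -- The first-order system for `(g, g')` is Lipschitz with constant `max 1 M` in the sup norm of
  -- the product.
  have key := ODE_solution_unique_of_mem_Ioo (a := -b) (b := b) (t₀ := 0)
    (v := fun t (y : ℂ × ℂ) => (y.2, Q t * y.1 - r t)) (s := fun _ => univ)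
    (K := (max 1 M).toNNReal) (f := fun x => (f x, f₁ x)) (g := fun x => (g x, g₁ x))
    (fun t _ => LipschitzWith.lipschitzOnWith (LipschitzWith.of_dist_le_mul fun y z => by
      rw [Real.coe_toNNReal _ (by positivity), Prod.dist_eq, Prod.dist_eq]
      refine max_le ?_ ?_
      · calc dist y.2 z.2 ≤ 1 * max (dist y.1 z.1) (dist y.2 z.2) := by
              rw [one_mul]; exact le_max_right _ _
          _ ≤ _ := by gcongr; exact le_max_left _ _
      · calc dist (Q t * y.1 - r t) (Q t * z.1 - r t) = ‖Q t‖ * dist y.1 z.1 := by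
              rw [dist_sub_right, dist_eq_norm, dist_eq_norm, ← mul_sub, norm_mul]
          _ ≤ _ := by
              gcongr
              · exact (hM t).trans (le_max_right _ _)
              · exact le_max_left _ _))
    ⟨by linarith, hb⟩ (fun t ht => ⟨(hf t ht).prodMk (hf₁ t ht), mem_univ _⟩)
    (fun t ht => ⟨(hg t ht).prodMk (hg₁ t ht), mem_univ _⟩) (by simp [h0, h1])
  intro x hx
  exact congrArg Prod.fst (key hx)

/-- The preimage of a solution of `g'' = Q g - r` under the transmutation operator. -/
theorem IsCharacteristicSolution.exists_preimage {Q : ℝ → ℂ} {H P : ℝ × ℝ → ℂ}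
    (hH : IsCharacteristicSolution Q H P) (hQ : Continuous Q) {M : ℝ} (hM : ∀ x, ‖Q x‖ ≤ M)
    {b : ℝ} (hb : 0 < b) (h : ℂ) {φ g g₁ : ℝ → ℂ} (hφ : Continuous φ)
    (hgc : ContinuousOn g (Icc (-b) b))
    (hg : ∀ x ∈ Ioo (-b) b, HasDerivAt g (g₁ x) x)
    (hg₁ : ∀ x ∈ Ioo (-b) b, HasDerivAt g₁
      (Q x * g x - (φ x + ∫ t in (-x)..x, kernelH (ofCharacteristic H) h x t * φ t)) x) :
    ∃ u u₁ : ℝ → ℂ, (∀ x, HasDerivAt u (u₁ x) x) ∧ (∀ x, HasDerivAt u₁ (-φ x) x) ∧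
      ∀ x ∈ Icc (-b) b,
        u x + ∫ t in (-x)..x, kernelH (ofCharacteristic H) h x t * u t = g x := by
  -- The initial data are forced by `(T u)(0) = u(0)` and `(T u)'(0) = u'(0) + h u(0)`.
  let u₁ : ℝ → ℂ := fun x => (g₁ 0 - h * g 0) + ∫ s in (0 : ℝ)..x, -φ s
  have hu₁ : ∀ x, HasDerivAt u₁ (-φ x) x := fun x =>
    (hφ.neg.integral_hasStrictDerivAt 0 x).hasDerivAt.const_add _
  have hcu₁ : Continuous u₁ := continuous_iff_continuousAt.2 fun x => (hu₁ x).continuousAt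
  let u : ℝ → ℂ := fun x => g 0 + ∫ s in (0 : ℝ)..x, u₁ s
  have hu : ∀ x, HasDerivAt u (u₁ x) x := fun x =>
    (hcu₁.integral_hasStrictDerivAt 0 x).hasDerivAt.const_add _
  have hcu : Continuous u := continuous_iff_continuousAt.2 fun x => (hu x).continuousAt
  have hu0 : u 0 = g 0 := by simp [u]
  have hu10 : u₁ 0 = g₁ 0 - h * g 0 := by simp [u₁]
  refine ⟨u, u₁, hu, hu₁, ?_⟩
  obtain ⟨hs, hs₁⟩ := hasDerivAt_symmIntegral h hu hu₁ hφ.neg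
  obtain ⟨w₁, hw0, hw, hw₁⟩ := hH.hasDerivAt_transmutation hQ hs hs₁
    (continuous_symmIntegral h hφ.neg)
  have hin : EqOn (fun x => symmIntegral h u x + charIntegral H (symmIntegral h u) x) g
      (Ioo (-b) b) := by
    refine eqOn_of_second_order hb hM
      (r := fun x => φ x + ∫ t in (-x)..x, kernelH (ofCharacteristic H) h x t * φ t)
      (fun x _ => hw x) (fun x _ => (hw₁ x).congr_deriv ?_) hg hg₁ ?_ ?_
    · rw [← integral_kernelH_mul hH.continuous h (u := fun t => -φ t) hφ.neg]
      simp only [mul_neg, intervalIntegral.integral_neg]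
      ring
    · simp [symmIntegral, charIntegral, hu0]
    · rw [hw0, hu10, neg_zero, hu0]
      ring
  have hwc : Continuous fun x => symmIntegral h u x + charIntegral H (symmIntegral h u) x :=
    continuous_iff_continuousAt.2 fun x => (hw x).continuousAt
  have hcl := hin.of_subset_closure hwc.continuousOn hgc Ioo_subset_Icc_self
    (by rw [closure_Ioo (by linarith)])
  intro x hx
  rw [integral_kernelH_mul hH.continuous h hcu]
  exact hcl hx

/-! ### Regularity of the coefficients -/

theorem toFun_of_mem {a b : ℝ} (v : C(Icc a b, ℂ)) {x : ℝ} (hx : x ∈ Icc a b) :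
    toFun v x = v ⟨x, hx⟩ :=
  Subtype.val_injective.extend_apply v 0 ⟨x, hx⟩

theorem continuousOn_toFun {a b : ℝ} (v : C(Icc a b, ℂ)) : ContinuousOn (toFun v) (Icc a b) := by
  rw [continuousOn_iff_continuous_domRestrict]
  exact v.continuous.congr fun x => (toFun_of_mem v x.2).symm

/-- A locally absolutely continuous function with a.e. continuous derivative is `C¹`. -/
theorem hasDerivAt_of_ae_hasDerivAt {A B : ℝ} {G n : ℝ → ℂ} (hn : ContinuousOn n (Ioo A B))
    (hG : ∀ c d : ℝ, A < c → c ≤ d → d < B → AbsolutelyContinuousOnInterval G c d)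
    (hae : ∀ᵐ y, y ∈ Ioo A B → HasDerivAt G (n y) y) : ∀ y ∈ Ioo A B, HasDerivAt G (n y) y := by
  intro y hy
  obtain ⟨c, hAc, hcy⟩ := exists_between hy.1
  obtain ⟨d, hyd, hdB⟩ := exists_between hy.2
  have hc : c ∈ Ioo A B := ⟨hAc, hcy.trans hy.2⟩
  have hsub : uIcc c d ⊆ Ioo A B := by
    rw [uIcc_of_le (hcy.trans hyd).le]
    exact fun z hz => ⟨hAc.trans_le hz.1, hz.2.trans_lt hdB⟩
  let N : ℝ → ℂ := fun z => ∫ s in c..z, n s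
  have hN : ∀ z ∈ Ioo A B, HasDerivAt N (n z) z := fun z hz =>
    intervalIntegral.integral_hasDerivAt_right
      ((hn.mono (ordConnected_Ioo.uIcc_subset hc hz)).intervalIntegrable)
      (hn.stronglyMeasurableAtFilter isOpen_Ioo _ hz) (hn.continuousAt (isOpen_Ioo.mem_nhds hz))
  have hN1 : ContDiffOn ℝ 1 N (Ioo A B) := by
    rw [show (1 : WithTop ℕ∞) = 0 + 1 from rfl, contDiffOn_succ_iff_deriv_of_isOpen isOpen_Ioo]
    refine ⟨fun z hz => (hN z hz).differentiableAt.differentiableWithinAt, by simp, ?_⟩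
    rw [contDiffOn_zero]
    exact hn.congr fun z hz => (hN z hz).deriv
  have hac := (hG c d hAc (hcy.trans hyd).le hdB).sub
    (hN1.mono hsub).absolutelyContinuousOnInterval
  obtain ⟨C, hC⟩ := hac.const_of_ae_hasDerivAt_zero (by
    filter_upwards [hae] with z hz hzm
    simpa using (hz (hsub hzm)).sub (hN z (hsub hzm)))
  refine ((hN y hy).add_const C).congr_of_eventuallyEq ?_
  filter_upwards [Icc_mem_nhds hcy hyd] with z hz
  rw [← hC z (by rwa [uIcc_of_le (hcy.trans hyd).le])]
  simp

namespace IsCoefficient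

variable {p : ℝ → ℝ} {A B : ℝ}

theorem continuousOn_deriv (hp : IsCoefficient p A B) : ContinuousOn (deriv p) (Ioo A B) := by
  intro y hy
  obtain ⟨c, hAc, hcy⟩ := exists_between hy.1
  obtain ⟨d, hyd, hdB⟩ := exists_between hy.2
  have := (hp.acLoc_deriv c d hAc (hcy.trans hyd).le hdB).continuousOn
  rw [uIcc_of_le (hcy.trans hyd).le] at this
  exact (this.continuousAt (Icc_mem_nhds hcy hyd)).continuousWithinAt

theorem contDiffOn (hp : IsCoefficient p A B) : ContDiffOn ℝ 1 p (Ioo A B) := by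
  rw [show (1 : WithTop ℕ∞) = 0 + 1 from rfl, contDiffOn_succ_iff_deriv_of_isOpen isOpen_Ioo]
  exact ⟨fun z hz => (hp.differentiable z hz).differentiableWithinAt, by simp,
    contDiffOn_zero.2 hp.continuousOn_deriv⟩

theorem continuousOn (hp : IsCoefficient p A B) : ContinuousOn p (Ioo A B) :=
  hp.contDiffOn.continuousOn

end IsCoefficient

/-- In terms of the fourth roots of `p` and `r`, all real powers in the Liouville formulas become
rational monomials, which `field_simp` and `ring` can handle. -/
theorem exists_fourth_roots {p r : ℝ} (hp : 0 < p) (hr : 0 < r) :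
    ∃ P R : ℝ, 0 < P ∧ 0 < R ∧ p = P ^ 4 ∧ r = R ^ 4 ∧ (r / p) ^ (1 / 2 : ℝ) = R ^ 2 / P ^ 2 ∧
      (p * r) ^ (1 / 4 : ℝ) = P * R ∧ (p * r) ^ (-(1 / 4) : ℝ) = (P * R)⁻¹ ∧
      (r ^ (-3 : ℝ) * p) ^ (1 / 4 : ℝ) = P / R ^ 3 := by
  have key : ∀ x : ℝ, 0 ≤ x → (x ^ 4) ^ (1 / 4 : ℝ) = x := fun x hx => by
    rw [← Real.rpow_natCast, ← Real.rpow_mul hx]; norm_num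
  have key2 : ∀ x : ℝ, 0 ≤ x → (x ^ 2) ^ (1 / 2 : ℝ) = x := fun x hx => by
    rw [← Real.rpow_natCast, ← Real.rpow_mul hx]; norm_num
  have hP : 0 < p ^ (1 / 4 : ℝ) := by positivity
  have hR : 0 < r ^ (1 / 4 : ℝ) := by positivity
  have hP4 : p = (p ^ (1 / 4 : ℝ)) ^ 4 := by
    rw [← Real.rpow_natCast, ← Real.rpow_mul hp.le]; norm_num
  have hR4 : r = (r ^ (1 / 4 : ℝ)) ^ 4 := by
    rw [← Real.rpow_natCast, ← Real.rpow_mul hr.le]; norm_num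
  generalize p ^ (1 / 4 : ℝ) = P at hP hP4
  generalize r ^ (1 / 4 : ℝ) = R at hR hR4
  subst hP4 hR4
  have h4 : (P ^ 4 * R ^ 4) ^ (1 / 4 : ℝ) = P * R := by
    rw [← mul_pow, key _ (by positivity)]
  refine ⟨P, R, hP, hR, rfl, rfl, ?_, h4, ?_, ?_⟩
  · rw [show R ^ 4 / P ^ 4 = (R ^ 2 / P ^ 2) ^ 2 by field_simp, key2 _ (by positivity)]
  · rw [Real.rpow_neg (by positivity), h4]
  · rw [Real.rpow_neg (by positivity), show ((R ^ 4) ^ (3 : ℝ))⁻¹ * P ^ 4 = (P / R ^ 3) ^ 4 by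
      rw [show (3 : ℝ) = (3 : ℕ) by norm_num, Real.rpow_natCast]; field_simp,
      key _ (by positivity)]

/-! ### The change of variable `l` -/

section Map

variable {A B : ℝ} {p r : ℝ → ℝ} {y₀ b : ℝ}

theorem continuousOn_liouville_density (hp : IsCoefficient p A B) (hr : IsCoefficient r A B) :
    ContinuousOn (fun s => (r s / p s) ^ (1 / 2 : ℝ)) (Ioo A B) :=
  (hr.continuousOn.div hp.continuousOn fun y hy => (hp.pos y hy).ne').rpow_const
    fun _ _ => Or.inr (by norm_num)

theorem liouville_density_pos (hp : IsCoefficient p A B) (hr : IsCoefficient r A B) {y : ℝ}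
    (hy : y ∈ Ioo A B) : 0 < (r y / p y) ^ (1 / 2 : ℝ) :=
  Real.rpow_pos_of_pos (div_pos (hr.pos y hy) (hp.pos y hy)) _

theorem hasDerivAt_liouvilleMap (hp : IsCoefficient p A B) (hr : IsCoefficient r A B)
    (hy₀ : y₀ ∈ Ioo A B) {y : ℝ} (hy : y ∈ Ioo A B) :
    HasDerivAt (liouvilleMap p r y₀) ((r y / p y) ^ (1 / 2 : ℝ)) y := by
  have hn := continuousOn_liouville_density hp hr
  exact intervalIntegral.integral_hasDerivAt_right
    ((hn.mono (ordConnected_Ioo.uIcc_subset hy₀ hy)).intervalIntegrable)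
    (hn.stronglyMeasurableAtFilter isOpen_Ioo _ hy) (hn.continuousAt (isOpen_Ioo.mem_nhds hy))

theorem continuousOn_liouvilleMap
    (hint : IntervalIntegrable (fun s => (r s / p s) ^ (1 / 2 : ℝ)) volume A B)
    (hy₀ : y₀ ∈ Ioo A B) : ContinuousOn (liouvilleMap p r y₀) (Icc A B) := by
  have hAB : A ≤ B := (hy₀.1.trans hy₀.2).le
  have := intervalIntegral.continuousOn_primitive_interval' hint (a := y₀)
    (by rw [uIcc_of_le hAB]; exact Ioo_subset_Icc_self hy₀)
  rwa [uIcc_of_le hAB] at this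

theorem strictMonoOn_liouvilleMap (hp : IsCoefficient p A B) (hr : IsCoefficient r A B)
    (hint : IntervalIntegrable (fun s => (r s / p s) ^ (1 / 2 : ℝ)) volume A B)
    (hy₀ : y₀ ∈ Ioo A B) : StrictMonoOn (liouvilleMap p r y₀) (Icc A B) := by
  refine strictMonoOn_of_deriv_pos (convex_Icc A B) (continuousOn_liouvilleMap hint hy₀) ?_
  intro y hy
  rw [interior_Icc] at hy
  rw [(hasDerivAt_liouvilleMap hp hr hy₀ hy).deriv]
  exact liouville_density_pos hp hr hy

theorem liouvilleMap_right (hb : b = ∫ s in y₀..B, (r s / p s) ^ (1 / 2 : ℝ)) :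
    liouvilleMap p r y₀ B = b := hb.symm

theorem liouvilleMap_left (hb : b = ∫ s in y₀..B, (r s / p s) ^ (1 / 2 : ℝ))
    (hsymm : (∫ s in A..y₀, (r s / p s) ^ (1 / 2 : ℝ)) =
      ∫ s in y₀..B, (r s / p s) ^ (1 / 2 : ℝ)) : liouvilleMap p r y₀ A = -b := by
  rw [liouvilleMap, intervalIntegral.integral_symm, hsymm, hb]

theorem bijOn_liouvilleMap (hp : IsCoefficient p A B) (hr : IsCoefficient r A B)
    (hint : IntervalIntegrable (fun s => (r s / p s) ^ (1 / 2 : ℝ)) volume A B)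
    (hy₀ : y₀ ∈ Ioo A B)
    (hsymm : (∫ s in A..y₀, (r s / p s) ^ (1 / 2 : ℝ)) =
      ∫ s in y₀..B, (r s / p s) ^ (1 / 2 : ℝ))
    (hb : b = ∫ s in y₀..B, (r s / p s) ^ (1 / 2 : ℝ)) :
    BijOn (liouvilleMap p r y₀) (Icc A B) (Icc (-b) b) := by
  have hAB : A ≤ B := (hy₀.1.trans hy₀.2).le
  have hm := strictMonoOn_liouvilleMap hp hr hint hy₀
  have hA := liouvilleMap_left hb hsymm
  have hB := liouvilleMap_right hb
  refine ⟨fun y hy => ⟨?_, ?_⟩, hm.injOn, ?_⟩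
  · rw [← hA]
    exact hm.monotoneOn (left_mem_Icc.2 hAB) hy hy.1
  · rw [← hB]
    exact hm.monotoneOn hy (right_mem_Icc.2 hAB) hy.2
  · have := intermediate_value_Icc hAB (continuousOn_liouvilleMap hint hy₀)
    rwa [hA, hB] at this

/-- A continuous bijection from a compact space to a Hausdorff space is a homeomorphism; this gives
continuity of the inverse picked by `Function.invFunOn`. -/
theorem exists_liouville_homeomorph
    (hint : IntervalIntegrable (fun s => (r s / p s) ^ (1 / 2 : ℝ)) volume A B)
    (hy₀ : y₀ ∈ Ioo A B) (hbij : BijOn (liouvilleMap p r y₀) (Icc A B) (Icc (-b) b)) :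
    ∃ e : Icc A B ≃ₜ Icc (-b) b, (∀ y, (e y : ℝ) = liouvilleMap p r y₀ y) ∧
      ∀ x : Icc (-b) b, liouvilleInv p r A B y₀ x = e.symm x := by
  have hc : Continuous (hbij.equiv (liouvilleMap p r y₀)) :=
    ((continuousOn_iff_continuous_domRestrict.1 (continuousOn_liouvilleMap hint hy₀)).subtype_mk _)
  let e := hc.homeoOfEquivCompactToT2
  have he : ∀ y, (e y : ℝ) = liouvilleMap p r y₀ y := fun y => rfl
  refine ⟨e, he, fun x => ?_⟩
  have hx : ∃ a ∈ Icc A B, liouvilleMap p r y₀ a = x := hbij.surjOn x.2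
  refine hbij.injOn (Function.invFunOn_mem hx) (e.symm x).2 ?_
  rw [← he, e.apply_symm_apply]
  exact Function.invFunOn_eq hx

theorem mem_Ioo_of_liouvilleMap_mem (hb : b = ∫ s in y₀..B, (r s / p s) ^ (1 / 2 : ℝ))
    (hsymm : (∫ s in A..y₀, (r s / p s) ^ (1 / 2 : ℝ)) =
      ∫ s in y₀..B, (r s / p s) ^ (1 / 2 : ℝ)) {y : ℝ} (hy : y ∈ Icc A B)
    (h : liouvilleMap p r y₀ y ∈ Ioo (-b) b) : y ∈ Ioo A B := by
  refine ⟨lt_of_le_of_ne hy.1 ?_, lt_of_le_of_ne hy.2 ?_⟩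
  · rintro rfl
    rw [liouvilleMap_left hb hsymm] at h
    exact lt_irrefl _ h.1
  · rintro rfl
    rw [liouvilleMap_right hb] at h
    exact lt_irrefl _ h.2

end Map

/-! ### The Liouville transform of the equation -/

section Transform

variable {A B : ℝ} {p r : ℝ → ℝ}

/-- The derivative of `(p r)^{-1/4}`. -/
def sigmaDeriv (p r : ℝ → ℝ) (y : ℝ) : ℝ :=
  -(1 / 4) * (p y * r y) ^ (-(5 / 4) : ℝ) * (deriv p y * r y + p y * deriv r y)

theorem hasDerivAt_sigma (hp : IsCoefficient p A B) (hr : IsCoefficient r A B) {y : ℝ}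
    (hy : y ∈ Ioo A B) :
    HasDerivAt (fun τ => (p τ * r τ) ^ (-(1 / 4) : ℝ)) (sigmaDeriv p r y) y := by
  have h1 := ((hp.differentiable y hy).hasDerivAt.mul (hr.differentiable y hy).hasDerivAt).rpow_const
    (p := -(1 / 4)) (Or.inl (mul_pos (hp.pos y hy) (hr.pos y hy)).ne')
  refine h1.congr_deriv ?_
  rw [sigmaDeriv, Pi.mul_apply, show (-(1 / 4) - 1 : ℝ) = -(5 / 4) by norm_num]
  ring

theorem contDiffOn_mul_rpow (hp : IsCoefficient p A B) (hr : IsCoefficient r A B) (a : ℝ) :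
    ContDiffOn ℝ 1 (fun y => (p y * r y) ^ a) (Ioo A B) :=
  (hp.contDiffOn.mul hr.contDiffOn).rpow_const_of_ne
    fun y hy => (mul_pos (hp.pos y hy) (hr.pos y hy)).ne'

/-- Here local absolute continuity of `p'` and `r'` enters: it lets `p ((p r)^{-1/4})'` be
differentiated a.e. and recovered from its derivative. -/
theorem acLoc_mul_sigmaDeriv (hp : IsCoefficient p A B) (hr : IsCoefficient r A B) :
    ACLoc (fun y => p y * sigmaDeriv p r y) A B := by
  intro c d hc hcd hd
  have hsub : uIcc c d ⊆ Ioo A B := by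
    rw [uIcc_of_le hcd]
    exact fun z hz => ⟨hc.trans_le hz.1, hz.2.trans_lt hd⟩
  have h1 := ((contDiffOn_mul_rpow hp hr (-(5 / 4))).mono hsub).absolutelyContinuousOnInterval
  have h2 := ((hp.acLoc_deriv c d hc hcd hd).mul (hr.acLoc c d hc hcd hd)).add
    ((hp.acLoc c d hc hcd hd).mul (hr.acLoc_deriv c d hc hcd hd))
  exact (hp.acLoc c d hc hcd hd).mul ((h1.const_mul (-(1 / 4))).mul h2)

/-- The quasi-derivative of the Liouville transform of `v`. -/
def quasiDeriv (p r : ℝ → ℝ) (v : ℝ → ℂ) (y : ℝ) : ℂ :=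
  (((p y * r y) ^ (-(1 / 4) : ℝ) : ℝ) : ℂ) * ((p y : ℂ) * deriv v y)
    - (p y * sigmaDeriv p r y) • v y

/-- As `dx = (r/p)^{1/2} dy`, this identifies `quasiDeriv` with the `x`-derivative of `ρ v`, using
that `ρ` is the reciprocal of `(p r)^{-1/4}`. -/
theorem hasDerivAt_rho_mul (hp : IsCoefficient p A B) (hr : IsCoefficient r A B) {v : ℝ → ℂ}
    {y : ℝ} (hy : y ∈ Ioo A B) (hv : DifferentiableAt ℝ v y) :
    HasDerivAt (fun s => (rho p r s : ℂ) * v s)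
      (((r y / p y) ^ (1 / 2 : ℝ) : ℝ) * quasiDeriv p r v y) y := by
  obtain ⟨P, R, hP, hR, hp4, hr4, h2, h4, h4', -⟩ := exists_fourth_roots (hp.pos y hy) (hr.pos y hy)
  have h1 : HasDerivAt (rho p r) (-sigmaDeriv p r y / ((p y * r y) ^ (-(1 / 4) : ℝ)) ^ 2) y := by
    refine ((hasDerivAt_sigma hp hr hy).inv (by rw [h4']; positivity)).congr_of_eventuallyEq ?_
    filter_upwards [isOpen_Ioo.mem_nhds hy] with s hs
    rw [Pi.inv_apply, Real.rpow_neg (mul_pos (hp.pos s hs) (hr.pos s hs)).le, inv_inv, rho]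
  refine (h1.ofReal_comp.mul hv.hasDerivAt).congr_deriv ?_
  rw [quasiDeriv, rho, h2, h4, h4', hp4, Complex.real_smul]
  have hPc : (P : ℂ) ≠ 0 := by exact_mod_cast hP.ne'
  have hRc : (R : ℂ) ≠ 0 := by exact_mod_cast hR.ne'
  push_cast
  field_simp
  ring

/-- With `σ = (p r)^{-1/4}`, the terms `σ' p v'` cancel and leave `σ (p v')' - (p σ')' v`, which the
definitions of the potential and of `C` turn into the stated value a.e. Its continuity makes the
identity hold everywhere. -/
theorem hasDerivAt_quasiDeriv (hp : IsCoefficient p A B) (hr : IsCoefficient r A B)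
    {q : ℝ → ℂ} {k : ℝ → ℂ} (hk : ContinuousOn k (Ioo A B))
    (hρ : ContinuousOn (rho p r) (Icc A B))
    (hkeq : ∀ᵐ y ∂(volume.restrict (Ioo A B)), k y = potential p r q y)
    {v w : C(Icc A B, ℂ)} (hv : IsC2 v)
    (hw : ∀ᵐ y ∂(volume.restrict (Ioo A B)), toFun w y = opC p r q v y) :
    ∀ y ∈ Ioo A B, HasDerivAt (quasiDeriv p r (toFun v))
      (((r y / p y) ^ (1 / 2 : ℝ) : ℝ) * (rho p r y * (k y * toFun v y - toFun w y))) y := by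
  have hv2 : ContDiffOn ℝ 2 (toFun v) (Ioo A B) := hv.mono Ioo_subset_Icc_self
  have hv1 : ContDiffOn ℝ 1 (deriv (toFun v)) (Ioo A B) :=
    ((contDiffOn_succ_iff_deriv_of_isOpen (n := 1) isOpen_Ioo).1
      (by rw [one_add_one_eq_two]; exact hv2)).2.2
  have hof : ∀ {f : ℝ → ℝ}, ContDiffOn ℝ 1 f (Ioo A B) →
      ContDiffOn ℝ 1 (fun y => (f y : ℂ)) (Ioo A B) := fun hf =>
    Complex.ofRealCLM.contDiff.comp_contDiffOn hf
  have hcv := (continuousOn_toFun v).mono Ioo_subset_Icc_self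
  have hcw := (continuousOn_toFun w).mono Ioo_subset_Icc_self
  refine hasDerivAt_of_ae_hasDerivAt ?_ ?_ ?_
  · exact (Complex.continuous_ofReal.comp_continuousOn (continuousOn_liouville_density hp hr)).mul
      ((Complex.continuous_ofReal.comp_continuousOn (hρ.mono Ioo_subset_Icc_self)).mul
        ((hk.mul hcv).sub hcw))
  · intro c d hc hcd hd
    have hsub : uIcc c d ⊆ Ioo A B := by
      rw [uIcc_of_le hcd]
      exact fun z hz => ⟨hc.trans_le hz.1, hz.2.trans_lt hd⟩
    have h1 := (((hof (contDiffOn_mul_rpow hp hr (-(1 / 4)))).mul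
      ((hof hp.contDiffOn).mul hv1)).mono hsub).absolutelyContinuousOnInterval
    have h2 := ((hv2.of_le one_le_two).mono hsub).absolutelyContinuousOnInterval
    exact h1.sub ((acLoc_mul_sigmaDeriv hp hr c d hc hcd hd).smul h2)
  -- Absolute continuity is known on compact subintervals only, so `(A, B)` is exhausted by
  -- countably many of them.
  · have hdiff : ∀ᵐ y, y ∈ Ioo A B → DifferentiableAt ℝ (fun y => p y * sigmaDeriv p r y) y := by
      rcases lt_or_ge A B with hAB | hAB
      · obtain ⟨a, ha⟩ := exists_seq_strictAnti_tendsto' hAB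
        obtain ⟨c, hc⟩ := exists_seq_strictMono_tendsto' hAB
        have hall : ∀ᵐ y, ∀ i j : ℕ, a i ≤ c j → y ∈ uIcc (a i) (c j) →
            DifferentiableAt ℝ (fun y => p y * sigmaDeriv p r y) y := by
          rw [ae_all_iff]; intro i
          rw [ae_all_iff]; intro j
          by_cases hij : a i ≤ c j
          · filter_upwards [(acLoc_mul_sigmaDeriv hp hr (a i) (c j) (ha.2.1 i).1 hij
              (hc.2.1 j).2).ae_differentiableAt] with y hy _ hm using hy hm
          · exact Eventually.of_forall fun y h => absurd h hij
        filter_upwards [hall] with y hy hm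
        obtain ⟨i, hi⟩ := (ha.2.2.eventually (gt_mem_nhds hm.1)).exists
        obtain ⟨j, hj⟩ := (hc.2.2.eventually (lt_mem_nhds hm.2)).exists
        exact hy i j (hi.trans hj).le (by rw [uIcc_of_le (hi.trans hj).le]; exact ⟨hi.le, hj.le⟩)
      · exact Eventually.of_forall fun y hy => absurd (hy.1.trans hy.2) hAB.not_gt
    rw [ae_restrict_iff' measurableSet_Ioo] at hkeq hw
    filter_upwards [hdiff, hkeq, hw] with y hd hky hwy hy
    have hnhds := isOpen_Ioo.mem_nhds hy
    obtain ⟨P, R, hP, hR, hp4, hr4, h2, h4, h4', h3⟩ :=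
      exists_fourth_roots (hp.pos y hy) (hr.pos y hy)
    have d1 := (hasDerivAt_sigma hp hr hy).ofReal_comp
    have d2 : HasDerivAt (fun s => (p s : ℂ) * deriv (toFun v) s) _ y :=
      (((hof hp.contDiffOn).mul hv1).contDiffAt hnhds |>.differentiableAt (by norm_num)).hasDerivAt
    have d3 := (hd hy).hasDerivAt
    have d4 : HasDerivAt (toFun v) _ y :=
      ((hv2.contDiffAt hnhds).differentiableAt (by norm_num)).hasDerivAt
    have e3 : deriv (fun s => p s * deriv (fun τ => (p τ * r τ) ^ (-(1 / 4) : ℝ)) s) y =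
        deriv (fun y => p y * sigmaDeriv p r y) y := by
      refine Filter.EventuallyEq.deriv_eq ?_
      filter_upwards [hnhds] with s hs
      rw [(hasDerivAt_sigma hp hr hs).deriv]
    refine ((d1.mul d2).sub (d3.smul d4)).congr_deriv ?_
    rw [hky hy, hwy hy, potential, opC, e3, h3, h2, rho, h4, h4', hr4, hp4]
    have hPc : (P : ℂ) ≠ 0 := by exact_mod_cast hP.ne'
    have hRc : (R : ℂ) ≠ 0 := by exact_mod_cast hR.ne'
    simp only [Complex.real_smul]
    push_cast
    field_simp
    ring

end Transform

/-- The Liouville transform of `v` satisfies `g'' = k g - L(Cv)` on the open interval. -/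
theorem exists_hasDerivAt_liouville {A B : ℝ} {p r : ℝ → ℝ} {y₀ b : ℝ} {q : ℝ → ℂ}
    (hp : IsCoefficient p A B) (hr : IsCoefficient r A B)
    (hρ : ContinuousOn (rho p r) (Icc A B)) (hy₀ : y₀ ∈ Ioo A B)
    (hsymm : (∫ s in A..y₀, (r s / p s) ^ (1 / 2 : ℝ)) =
      ∫ s in y₀..B, (r s / p s) ^ (1 / 2 : ℝ))
    (hb : b = ∫ s in y₀..B, (r s / p s) ^ (1 / 2 : ℝ))
    {Q : ℝ → ℂ} (hQ : ContinuousOn Q (Icc (-b) b))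
    (hQeq : ∀ᵐ y ∂(volume.restrict (Ioo A B)), Q (liouvilleMap p r y₀ y) = potential p r q y)
    (e : Icc A B ≃ₜ Icc (-b) b) (he : ∀ y, (e y : ℝ) = liouvilleMap p r y₀ y)
    (he' : ∀ x : Icc (-b) b, liouvilleInv p r A B y₀ x = e.symm x)
    {v w : C(Icc A B, ℂ)} (hv : IsC2 v)
    (hw : ∀ᵐ y ∂(volume.restrict (Ioo A B)), toFun w y = opC p r q v y) :
    ∃ g₁ : ℝ → ℂ,
      (∀ x ∈ Ioo (-b) b, HasDerivAt (fun x => (rho p r (liouvilleInv p r A B y₀ x) : ℂ) *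
        toFun v (liouvilleInv p r A B y₀ x)) (g₁ x) x) ∧
      ∀ x ∈ Ioo (-b) b, HasDerivAt g₁ (Q x * ((rho p r (liouvilleInv p r A B y₀ x) : ℂ) *
        toFun v (liouvilleInv p r A B y₀ x)) - (rho p r (liouvilleInv p r A B y₀ x) : ℂ) *
        toFun w (liouvilleInv p r A B y₀ x)) x := by
  set j := liouvilleInv p r A B y₀ with hj
  have hlj : ∀ x ∈ Icc (-b) b, j x ∈ Icc A B ∧ liouvilleMap p r y₀ (j x) = x := by
    intro x hx
    rw [he' ⟨x, hx⟩]
    refine ⟨(e.symm ⟨x, hx⟩).2, ?_⟩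
    rw [← he, e.apply_symm_apply]
  have hmem : ∀ x ∈ Ioo (-b) b, j x ∈ Ioo A B := fun x hx => by
    obtain ⟨h1, h2⟩ := hlj x (Ioo_subset_Icc_self hx)
    exact mem_Ioo_of_liouvilleMap_mem hb hsymm h1 (by rwa [h2])
  have hcj : ContinuousOn j (Icc (-b) b) := by
    rw [continuousOn_iff_continuous_domRestrict]
    exact (continuous_subtype_val.comp e.symm.continuous).congr fun x => (he' x).symm
  have hdj : ∀ x ∈ Ioo (-b) b,
      HasDerivAt j ((r (j x) / p (j x)) ^ (1 / 2 : ℝ))⁻¹ x := by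
    intro x hx
    refine HasDerivAt.of_local_left_inverse
      (hcj.continuousAt (Icc_mem_nhds hx.1 hx.2))
      (hasDerivAt_liouvilleMap hp hr hy₀ (hmem x hx))
      (liouville_density_pos hp hr (hmem x hx)).ne' ?_
    filter_upwards [isOpen_Ioo.mem_nhds hx] with z hz
    exact (hlj z (Ioo_subset_Icc_self hz)).2
  have hmaps : MapsTo (liouvilleMap p r y₀) (Ioo A B) (Icc (-b) b) := fun y hy => by
    rw [← he ⟨y, Ioo_subset_Icc_self hy⟩]
    exact (e _).2
  have hk : ContinuousOn (fun y => Q (liouvilleMap p r y₀ y)) (Ioo A B) :=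
    hQ.comp (fun y hy => (hasDerivAt_liouvilleMap hp hr hy₀ hy).continuousAt.continuousWithinAt)
      hmaps
  have hG := hasDerivAt_quasiDeriv hp hr hk hρ hQeq hv hw
  refine ⟨fun x => quasiDeriv p r (toFun v) (j x), fun x hx => ?_, fun x hx => ?_⟩
  · have hy := hmem x hx
    have hvd : DifferentiableAt ℝ (toFun v) (j x) :=
      (hv.contDiffAt (Icc_mem_nhds hy.1 hy.2)).differentiableAt (by norm_num)
    refine ((hasDerivAt_rho_mul hp hr hy hvd).scomp x (hdj x hx)).congr_deriv ?_
    have hne := (liouville_density_pos hp hr hy).ne'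
    rw [Complex.real_smul, ← mul_assoc, ← Complex.ofReal_mul, inv_mul_cancel₀ hne,
      Complex.ofReal_one, one_mul]
  · have hy := hmem x hx
    refine ((hG _ hy).scomp x (hdj x hx)).congr_deriv ?_
    have hne := (liouville_density_pos hp hr hy).ne'
    rw [Complex.real_smul, ← mul_assoc, ← Complex.ofReal_mul, inv_mul_cancel₀ hne,
      Complex.ofReal_one, one_mul, (hlj x (Ioo_subset_Icc_self hx)).2]
    ring

/-! ### The operators `L` and `T`, and the theorem -/

theorem exists_liouville_operator {A B b : ℝ} (e : Icc A B ≃ₜ Icc (-b) b) {ρ : ℝ → ℝ}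
    (hρ : ContinuousOn ρ (Icc A B)) :
    ∃ L : C(Icc A B, ℂ) →L[ℂ] C(Icc (-b) b, ℂ), ∀ v x, L v x = (ρ (e.symm x) : ℂ) * v (e.symm x) := by
  let m : C(Icc (-b) b, ℂ) := ⟨fun x => (ρ (e.symm x) : ℂ), Complex.continuous_ofReal.comp
    ((continuousOn_iff_continuous_domRestrict.1 hρ).comp e.symm.continuous)⟩
  refine ⟨{ toFun := fun v => m * v.comp e.symm
            map_add' := fun u v => by ext x; simp [mul_add]
            map_smul' := fun a v => by ext x; simp [mul_left_comm]
            cont := ?_ }, fun v x => rfl⟩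
  exact continuous_const.mul (ContinuousMap.continuous_precomp _)

/-- Invertibility of the transmutation operator, with its action on `C²`. -/
theorem exists_transmutation_equiv {b : ℝ} (hb : 0 < b) {H : ℝ × ℝ → ℂ} (hH : Continuous H)
    (h : ℂ) : ∃ T : C(Icc (-b) b, ℂ) ≃L[ℂ] C(Icc (-b) b, ℂ),
      ∀ (u : C(Icc (-b) b, ℂ)) (x : Icc (-b) b) (u' : ℝ → ℂ), Continuous u' →
        (∀ t : Icc (-b) b, u' t = u t) →
        T u x = u' x + ∫ t in (-(x : ℝ))..(x : ℝ),
          kernelH (ofCharacteristic H) h x t * u' t := by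
  have hb' : -b ≤ b := by linarith
  -- `T` is built as a product of two invertible Volterra factors. The values of `u'` off `[-b, b]`
  -- never enter, since `|t| ≤ |x| ≤ b`.
  obtain ⟨S, hS⟩ := exists_volterra_equiv hb' (k := fun _ => h / 2) continuous_const
  obtain ⟨T, hT⟩ := exists_volterra_equiv hb' (k := ofCharacteristic H)
    (by unfold ofCharacteristic; fun_prop)
  have hsub : ∀ x ∈ Icc (-b) b, uIcc (-x) x ⊆ Icc (-b) b := fun x hx =>
    uIcc_subset_Icc ⟨by linarith [hx.2], by linarith [hx.1]⟩ hx
  have hSu : ∀ (u : C(Icc (-b) b, ℂ)) (u' : ℝ → ℂ), (∀ t : Icc (-b) b, u' t = u t) →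
      ∀ x : Icc (-b) b, S u x = symmIntegral h u' x := by
    intro u u' huu x
    rw [hS, symmIntegral, huu]
    congr 1
    refine intervalIntegral.integral_congr fun t ht => ?_
    have ht' := hsub x x.2 ht
    rw [IccExtend_of_mem _ _ ht', ← huu]
  refine ⟨S.trans T, fun u x u' hu' huu => ?_⟩
  rw [integral_kernelH_mul hH h hu', charIntegral_eq, ContinuousLinearEquiv.trans_apply, hT,
    hSu u u' huu]
  congr 1
  refine intervalIntegral.integral_congr fun t ht => ?_
  have ht' := hsub x x.2 ht
  rw [IccExtend_of_mem _ _ ht', hSu u u' huu]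

theorem isC2_and_opA {b : ℝ} (hb : 0 < b) {u u₁ u₂ : ℝ → ℂ} (hu : ∀ x, HasDerivAt u (u₁ x) x)
    (hu₁ : ∀ x, HasDerivAt u₁ (u₂ x) x) (hu₂ : Continuous u₂) {U : C(Icc (-b) b, ℂ)}
    (hU : ∀ t : Icc (-b) b, u t = U t) :
    IsC2 U ∧ ∀ x : Icc (-b) b, opA U x = -u₂ x := by
  have e1 : deriv u = u₁ := funext fun x => (hu x).deriv
  have e2 : deriv u₁ = u₂ := funext fun x => (hu₁ x).deriv
  have hu1 : ContDiff ℝ 1 u₁ := by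
    rw [contDiff_one_iff_deriv, e2]
    exact ⟨fun x => (hu₁ x).differentiableAt, hu₂⟩
  have hu2 : ContDiff ℝ 2 u := by
    rw [show (2 : WithTop ℕ∞) = 1 + 1 from one_add_one_eq_two.symm, contDiff_succ_iff_deriv, e1]
    exact ⟨fun x => (hu x).differentiableAt, by simp, hu1⟩
  have heq : EqOn (toFun U) u (Icc (-b) b) := fun x hx => by
    rw [toFun_of_mem U hx, ← hU]
  refine ⟨hu2.contDiffOn.congr heq, fun x => ?_⟩
  rw [opA, iteratedDerivWithin_congr heq x.2,
    iteratedDerivWithin_eq_iteratedDeriv (uniqueDiffOn_Icc (by linarith)) hu2.contDiffAt x.2,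
    iteratedDeriv_succ, iteratedDeriv_one, e1, e2]

end LiouvilleTransmutation

end

open LiouvilleTransmutation in
theorem mainTheorem3
    (A B : ℝ) (p r : ℝ → ℝ) (q : ℝ → ℂ)
    (hp : LiouvilleTransmutation.IsCoefficient p A B)
    (hr : LiouvilleTransmutation.IsCoefficient r A B)
    (hint : IntervalIntegrable (fun s => (r s / p s) ^ (1 / 2 : ℝ)) volume A B)
    -- the Liouville operator acts on continuous functions on the closed interval
    (hρ : ContinuousOn (LiouvilleTransmutation.rho p r) (Icc A B))
    (y₀ : ℝ) (hy₀ : y₀ ∈ Ioo A B)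
    (hsymm : (∫ s in A..y₀, (r s / p s) ^ (1 / 2 : ℝ)) =
      ∫ s in y₀..B, (r s / p s) ^ (1 / 2 : ℝ))
    (b : ℝ) (hb : b = ∫ s in y₀..B, (r s / p s) ^ (1 / 2 : ℝ))
    -- the continuous potential of the transformed equation
    (Q : ℝ → ℂ) (hQ : ContinuousOn Q (Icc (-b) b))
    (hQeq : ∀ᵐ y ∂(volume.restrict (Ioo A B)),
      Q (LiouvilleTransmutation.liouvilleMap p r y₀ y) =
        LiouvilleTransmutation.potential p r q y)
    -- the nonvanishing particular solution
    (f : ℝ → ℂ) (hf : ContDiffOn ℝ 2 f (Icc (-b) b))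
    (hfeq : ∀ x ∈ Icc (-b) b, iteratedDerivWithin 2 f (Icc (-b) b) x - Q x * f x = 0)
    (hf_ne : ∀ x ∈ Icc (-b) b, f x ≠ 0) (hf0 : f 0 = 1)
    (h : ℂ) (hh : h = deriv f 0) :
    -- `l` is a bijection of `[A, B]` onto `[-b, b]`
    BijOn (LiouvilleTransmutation.liouvilleMap p r y₀) (Icc A B) (Icc (-b) b) ∧
    -- the Goursat problem is uniquely solvable
    ∃ K : ℝ × ℝ → ℂ, LiouvilleTransmutation.IsGoursatSolution Q b K ∧
      (∀ K' : ℝ × ℝ → ℂ, LiouvilleTransmutation.IsGoursatSolution Q b K' →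
        EqOn K' K (Icc (-b) b ×ˢ Icc (-b) b)) ∧
      -- the operators `L` and `T` (the latter invertible) given by their formulas
      ∃ (L : C(Icc A B, ℂ) →L[ℂ] C(Icc (-b) b, ℂ))
        (T : C(Icc (-b) b, ℂ) ≃L[ℂ] C(Icc (-b) b, ℂ)),
        (∀ (v : C(Icc A B, ℂ)) (x : Icc (-b) b),
          L v x =
            (LiouvilleTransmutation.rho p r
              (LiouvilleTransmutation.liouvilleInv p r A B y₀ x) : ℂ) *
            LiouvilleTransmutation.toFun v
              (LiouvilleTransmutation.liouvilleInv p r A B y₀ x)) ∧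
        (∀ (u : C(Icc (-b) b, ℂ)) (x : Icc (-b) b),
          T u x = u x + ∫ t in (-(x : ℝ))..(x : ℝ),
            LiouvilleTransmutation.kernelH K h x t * LiouvilleTransmutation.toFun u t) ∧
        -- `A T⁻¹ L v = T⁻¹ L C v` for `v ∈ C²[A, B]` with `w = C v ∈ C[A, B]`
        ∀ v w : C(Icc A B, ℂ), LiouvilleTransmutation.IsC2 v →
          (∀ᵐ y ∂(volume.restrict (Ioo A B)),
            LiouvilleTransmutation.toFun w y = LiouvilleTransmutation.opC p r q v y) →
          LiouvilleTransmutation.IsC2 (T.symm (L v)) ∧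
          ∀ x : Icc (-b) b,
            LiouvilleTransmutation.opA (T.symm (L v)) x = T.symm (L w) x := by
  have hbij := bijOn_liouvilleMap hp hr hint hy₀ hsymm hb
  refine ⟨hbij, ?_⟩
  obtain ⟨e, he, he'⟩ := exists_liouville_homeomorph hint hy₀ hbij
  have hb0 : 0 < b := by
    have h1 := strictMonoOn_liouvilleMap hp hr hint hy₀ (Ioo_subset_Icc_self hy₀)
      (right_mem_Icc.2 (hy₀.1.trans hy₀.2).le) hy₀.2
    rwa [liouvilleMap_right hb, liouvilleMap, intervalIntegral.integral_same] at h1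
  have hb' : -b ≤ b := by linarith
  obtain ⟨M, hM⟩ := isCompact_Icc.exists_bound_of_continuousOn hQ
  -- Extending `Q` by its endpoint values makes it continuous and bounded on the line, so `H` can be
  -- solved for on the whole plane.
  let Qe : ℝ → ℂ := IccExtend hb' ((Icc (-b) b).domRestrict Q)
  have hQe : Continuous Qe := (continuousOn_iff_continuous_domRestrict.1 hQ).Icc_extend'
  have hQeM : ∀ x, ‖Qe x‖ ≤ M := fun x => hM _ (projIcc (-b) b hb' x).2
  have hQQ : EqOn Q Qe (Icc (-b) b) := fun x hx =>
    (IccExtend_of_mem hb' ((Icc (-b) b).domRestrict Q) hx).symm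
  obtain ⟨H, P, hH⟩ := exists_isCharacteristicSolution hQe hQeM
  have hK := hH.isGoursatSolution hQQ
  refine ⟨ofCharacteristic H, hK, fun K' hK' => hK.eqOn hb0 hQ hK', ?_⟩
  obtain ⟨L, hL⟩ := exists_liouville_operator e hρ
  obtain ⟨T, hT⟩ := exists_transmutation_equiv hb0 hH.continuous h
  have hLx : ∀ (v : C(Icc A B, ℂ)) (x : Icc (-b) b), L v x =
      (rho p r (liouvilleInv p r A B y₀ x) : ℂ) * toFun v (liouvilleInv p r A B y₀ x) := by
    intro v x
    rw [hL, he', toFun_of_mem v (e.symm x).2]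
  have hext : ∀ u : C(Icc (-b) b, ℂ), Continuous (IccExtend hb' u) := fun u =>
    u.continuous.Icc_extend'
  have hextv : ∀ (u : C(Icc (-b) b, ℂ)) (t : Icc (-b) b), IccExtend hb' u t = u t := fun u t =>
    IccExtend_val hb' u t
  refine ⟨L, T, hLx, fun u x => ?_, fun v w hv hw => ?_⟩
  · rw [hT u x _ (hext u) (hextv u), hextv]
    congr 1
    refine intervalIntegral.integral_congr fun t ht => ?_
    have ht' : t ∈ Icc (-b) b :=
      uIcc_subset_Icc ⟨by linarith [x.2.2], by linarith [x.2.1]⟩ x.2 ht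
    rw [IccExtend_of_mem _ _ ht', toFun_of_mem u ht']
  · obtain ⟨g₁, hg, hg₁⟩ := exists_hasDerivAt_liouville hp hr hρ hy₀ hsymm hb hQ hQeq e he he' hv hw
    have hTφ : ∀ x ∈ Icc (-b) b, (rho p r (liouvilleInv p r A B y₀ x) : ℂ) *
        toFun w (liouvilleInv p r A B y₀ x) = IccExtend hb' (T.symm (L w)) x +
          ∫ t in (-x)..x, kernelH (ofCharacteristic H) h x t *
            IccExtend hb' (T.symm (L w)) t := by
      intro x hx
      have h1 := hT (T.symm (L w)) ⟨x, hx⟩ _ (hext _) (hextv _)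
      rw [T.apply_symm_apply, hLx] at h1
      exact h1
    -- Here `φ` is the constant extension of `T⁻¹ L w`, so the resulting `u` satisfies `-u'' = T⁻¹ L
    -- w` on `[-b, b]`.
    obtain ⟨u, u₁, hu, hu₁, hTu⟩ := hH.exists_preimage hQe hQeM hb0 h (hext (T.symm (L w)))
      (g := fun x => (rho p r (liouvilleInv p r A B y₀ x) : ℂ) *
        toFun v (liouvilleInv p r A B y₀ x)) (g₁ := g₁)
      (by
        rw [continuousOn_iff_continuous_domRestrict]
        exact (L v).continuous.congr fun x => hLx v x)
      hg (fun x hx => by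
        have hx' := Ioo_subset_Icc_self hx
        rw [← hTφ x hx', ← hQQ hx']
        exact hg₁ x hx)
    have hcu : Continuous u := continuous_iff_continuousAt.2 fun x => (hu x).continuousAt
    let U : C(Icc (-b) b, ℂ) := ⟨fun x => u x, hcu.comp continuous_subtype_val⟩
    have hTU : T.symm (L v) = U := by
      rw [ContinuousLinearEquiv.symm_apply_eq]
      ext x
      rw [hT U x u hcu (fun _ => rfl), hTu x x.2, hLx]
    rw [hTU]
    obtain ⟨h2, hA⟩ := isC2_and_opA hb0 hu hu₁ (hext (T.symm (L w))).neg (U := U) (fun _ => rfl)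
    refine ⟨h2, fun x => ?_⟩
    rw [hA, neg_neg, hextv]
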